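/- Let \(\mathfrak z\) be a Euclidean vector space of dimension \(n=\dim\mathfrak z\), with Clifford algebra \(\mathrm{Cl}(\mathfrak z)\) normalized by \(Z\cdot Z=-\|Z\|^2\). Let \(\mathfrak v\neq 0\) be a finite-dimensional real \(\mathrm{Cl}(\mathfrak z)\)-module with a scalar product for which every \(Z\in\mathfrak z\) acts skew-symmetrically; write \(Z\bullet S\) for the action of \(Z\in\mathfrak z\) on \(S\in\mathfrak v\). Let \(\mathfrak n=\mathfrak z\oplus\mathfrak v\) be the orthogonal sum, write \(X=X_{\mathfrak z}\oplus X_{\mathfrak v}\) for \(X\in\mathfrak n\), and let \(D=\{X\in\mathfrak n : X_{\mathfrak z}\neq0,\ X_{\mathfrak v}\neq0\}\). For \(X\in D\) let \(\check{\mathrm K}(X)\colon\mathfrak z\to\mathfrak z\) be the (skew-symmetric) operator with \[ \langle\check{\mathrm K}(X)Z_1,Z_2\rangle=\frac{\langle Z_1\bullet X_{\mathfrak z}\bullet X_{\mathfrak v},\;Z_2\bullet X_{\mathfrak v}\rangle}{\|X_{\mathfrak z}\|\,\|X_{\mathfrak v}\|^2}\qquad\text{for all }Z_1,Z_2\in\mathfrak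 z . \] Let \(R\subseteq D\) be the complement of the ramification locus of \(-\check{\mathrm K}^2\), i.e. the open set of those \(X\in D\) near which the number of distinct eigenvalues of \(-\check{\mathrm K}^2\) (equivalently, their multiplicities) is constant. An eigenvalue branch of \(-\check{\mathrm K}^2\) on a connected component \(U\) of \(R\) is a real-analytic function \(\check\mu\colon U\to\mathbb R\) such that \(\check\mu(X)\) is an eigenvalue of \(-\check{\mathrm K}(X)^2\) for every \(X\in U\). Suppose \(n\ge10\). Then \(\dim\mathfrak v>8n-28\), and every eigenvalue branch \(\check\mu\) of \(-\check{\mathrm K}^2\) that is not identically zero, on any connected component \(U\) of \(R\), has multiplicity exactly \(2\): for every \(X\in U\), the eigenspace of \(-\check{\mathrm K}(X)^2\) for the eigenvalue \(\check\mu(X)\) has dimension \(2\). -/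

import Mathlib

namespace HType

open scoped Topology

noncomputable section

/-- The quadratic form `Q Z = -‖Z‖²` on a Euclidean vector space `z`. The Clifford algebra
`Cl(z, g)` is the one in which `Z * Z = -‖Z‖²`, that is `CliffordAlgebra (cliffordForm z)`. -/
def cliffordForm (z : Type*) [NormedAddCommGroup z] [InnerProductSpace ℝ z] :
    QuadraticForm ℝ z :=
  -LinearMap.BilinMap.toQuadraticMap (innerₗ z)

theorem cliffordForm_apply {z : Type*} [NormedAddCommGroup z] [InnerProductSpace ℝ z] (Z : z) :
    cliffordForm z Z = -‖Z‖ ^ 2 := by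
  simp [cliffordForm]

section Module

variable {z v : Type*} [NormedAddCommGroup z] [InnerProductSpace ℝ z]
  [NormedAddCommGroup v] [InnerProductSpace ℝ v]
  [Module (CliffordAlgebra (cliffordForm z)) v]
  [IsScalarTower ℝ (CliffordAlgebra (cliffordForm z)) v]

/-- Clifford multiplication `Z • S` of a spinor `S : v` by a vector `Z : z`,
for a module `v` over the Clifford algebra of `z`, as a bilinear map. -/
def cmul : z →ₗ[ℝ] v →ₗ[ℝ] v :=
  (Algebra.lsmul ℝ ℝ v).toLinearMap ∘ₗ CliffordAlgebra.ι (cliffordForm z)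

theorem cmul_apply (Z : z) (S : v) :
    cmul Z S = CliffordAlgebra.ι (cliffordForm z) Z • S := rfl

theorem cmul_cmul (Z : z) (S : v) : cmul Z (cmul Z S) = -(‖Z‖ ^ 2 • S) := by
  rw [cmul_apply, cmul_apply, smul_smul, CliffordAlgebra.ι_sq_scalar, algebraMap_smul,
    cliffordForm_apply, neg_smul]

variable (z v) in
/-- The scalar product of the Clifford module `v` makes it an orthogonal Clifford module:
every vector of `z` acts as a skew-symmetric operator. -/
def IsOrthogonalModule : Prop :=
  ∀ (Z : z) (S T : v), inner ℝ (cmul Z S) T = -inner ℝ S (cmul Z T)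

variable [FiniteDimensional ℝ z] [FiniteDimensional ℝ v]

/-- The operator `K̂(X) : z → z` for `X = X_z ⊕ X_v` in the orthogonal sum `n = z ⊕ v`,
characterized by `⟪K̂(X) Z₁, Z₂⟫ = ⟪Z₁ • X_z • X_v, Z₂ • X_v⟫` (see `inner_Khat`). -/
def Khat (X : WithLp 2 (z × v)) : z →ₗ[ℝ] z :=
  LinearMap.adjoint (cmul.flip X.snd) ∘ₗ cmul.flip (cmul X.fst X.snd)

theorem inner_Khat (X : WithLp 2 (z × v)) (Z₁ Z₂ : z) :
    inner ℝ (Khat X Z₁) Z₂ =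
      inner ℝ (cmul Z₁ (cmul X.fst X.snd)) (cmul Z₂ X.snd) := by
  simp [Khat, LinearMap.adjoint_inner_left]

/-- The rescaled operator `Ǩ(X) = K̂(X) / (‖X_z‖ ‖X_v‖²)`; it is only used
for `X` in the domain `domainD z v`. -/
def Kcheck (X : WithLp 2 (z × v)) : z →ₗ[ℝ] z :=
  (‖X.fst‖ * ‖X.snd‖ ^ 2)⁻¹ • Khat X

/-- The operator `-Ǩ(X)²`. -/
def negKcheckSq (X : WithLp 2 (z × v)) : Module.End ℝ z :=
  -(Kcheck X ∘ₗ Kcheck X)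

variable (z v) in
/-- The domain `D` of the family `-Ǩ²`: both components of `X` are nonzero. -/
def domainD : Set (WithLp 2 (z × v)) := {X | X.fst ≠ 0 ∧ X.snd ≠ 0}

/-- The number of distinct eigenvalues of `-Ǩ(X)²`
(the operator is self-adjoint, so all its eigenvalues are real). -/
def numEigenvalues (X : WithLp 2 (z × v)) : ℕ :=
  {c : ℝ | (negKcheckSq X).HasEigenvalue c}.ncard

variable (z v) in
/-- The complement of the ramification locus of `-Ǩ²`: the largest open subset of `D` on which
the number of distinct eigenvalues is locally constant, i.e. on which eigenvalues neither merge
nor split. As the eigenvalues depend continuously on `X`, this is also the largest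
open subset of `D` on which the eigenvalue multiplicities are locally constant. -/
def regularSet : Set (WithLp 2 (z × v)) :=
  {X | X ∈ domainD z v ∧ ∀ᶠ Y in 𝓝 X, numEigenvalues Y = numEigenvalues X}

variable (z v) in
/-- `U` is a connected component of the complement of the ramification locus. -/
def IsRegularComponent (U : Set (WithLp 2 (z × v))) : Prop :=
  ∃ X ∈ regularSet z v, U = connectedComponentIn (regularSet z v) X

/-- `μ` is an eigenvalue branch of `-Ǩ²` on `U`: a real-analytic function on `U` whose value at
each `X ∈ U` is an eigenvalue of `-Ǩ(X)²`. (Values of `μ` outside `U` are irrelevant.) -/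
def IsEigenvalueBranch (U : Set (WithLp 2 (z × v))) (μ : WithLp 2 (z × v) → ℝ) : Prop :=
  AnalyticOnNhd ℝ μ U ∧ ∀ X ∈ U, (negKcheckSq X).HasEigenvalue (μ X)

/-- The branch `μ` on `U` has multiplicity `m`: for every `X ∈ U` the eigenspace of `-Ǩ(X)²`
for the eigenvalue `μ X` has dimension `m`. -/
def HasBranchMultiplicity (U : Set (WithLp 2 (z × v))) (μ : WithLp 2 (z × v) → ℝ) (m : ℕ) :
    Prop :=
  ∀ X ∈ U, Module.finrank ℝ ((negKcheckSq X).eigenspace (μ X)) = m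

end Module

end

end HType

/-!
Multiplicity two of the nonzero eigenvalues of `-Ǩ²`.

Fix `x ≠ 0` in `z`, and let `S` be a spinor near which the number of eigenvalues of the symmetric
operator `-K̂(x ⊕ S)²` is locally constant. First-order perturbation theory
(`exists_compression_eq_smul`) shows that the compression of its derivative to each eigenspace is a
scalar, for every variation of `S`. An eigenspace for a nonzero eigenvalue is even-dimensional and
orthogonal to `x`. If its dimension is not two, it contains an orthonormal frame `e₀, …, e₃` on which
`K̂` acts by a multiple of `e₀ ↦ e₁ ↦ -e₀`, `e₂ ↦ e₃ ↦ -e₂`, and comparing the two planes gives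
`e₀ e₁ S = e₂ e₃ S`, that is `e₀ e₁ e₂ e₃ S = -S` (`IsOrthogonalModule.mem_badSpinors`).

Such spinors are rare. The product `e₀ e₁ e₂ e₃` depends only on an oriented four-plane in the
orthogonal complement of `x`, and its `-1`-eigenspace has half the dimension of `v`. Putting the frame
into echelon form shows that these spinors lie in finitely many smooth images of spaces of dimension
at most `4 dim z - 13 + dim v / 2`. This is less than `dim v` when `dim v > 8 dim z - 26`, and
then the complement is dense (`dense_compl_badSpinors`). The dimension bound
`IsOrthogonalModule.finrank_bound` comes from the eight-fold periodicity of Clifford modules, in the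
form of four commuting involutions given by the extended Hamming code.

So at any regular point `x ⊕ S` there are spinors `T` near `S`, with the same number `k` of
eigenvalues, for which all nonzero eigenvalues have multiplicity two. Then the rank at `T` is
`2 (k - 1)`; it is at least `2 (k - 1)` at `S`, with equality only if all multiplicities there are
two. Lower semicontinuity of the rank forces equality (`IsOrthogonalModule.finrank_eigenspace_eq_two`).
The rank is thus locally constant on the regular set, so that no nonzero eigenvalue can tend to zero
there, and a branch on a connected component vanishes everywhere or nowhere
(`IsOrthogonalModule.branch_ne_zero`).
-/

namespace HType

open scoped Topology

/-! ### Clifford relations -/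

section Clifford

variable {z v : Type*} [NormedAddCommGroup z] [InnerProductSpace ℝ z]
  [NormedAddCommGroup v] [InnerProductSpace ℝ v]
  [Module (CliffordAlgebra (cliffordForm z)) v]
  [IsScalarTower ℝ (CliffordAlgebra (cliffordForm z)) v]

theorem cmul_cmul_add (Z W : z) (S : v) :
    cmul Z (cmul W S) + cmul W (cmul Z S) = -((2 * inner ℝ Z W) • S) := by
  have h := cmul_cmul (Z + W) S
  have h1 := cmul_cmul Z S
  have h2 := cmul_cmul W S
  simp only [map_add, LinearMap.add_apply] at h
  rw [h1, h2, norm_add_sq_real] at h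
  have : cmul Z (cmul W S) + cmul W (cmul Z S) =
      -((‖Z‖ ^ 2 + 2 * inner ℝ Z W + ‖W‖ ^ 2) • S) + ‖Z‖ ^ 2 • S + ‖W‖ ^ 2 • S := by
    rw [← h]; abel
  rw [this]
  module

theorem cmul_anticomm {Z W : z} (h : inner ℝ Z W = 0) (S : v) :
    cmul Z (cmul W S) = -cmul W (cmul Z S) := by
  have := cmul_cmul_add Z W S
  rw [h, mul_zero, zero_smul, neg_zero] at this
  exact eq_neg_of_add_eq_zero_left this

theorem cmul_cmul_of_norm_eq_one {Z : z} (h : ‖Z‖ = 1) (S : v) : cmul Z (cmul Z S) = -S := by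
  rw [cmul_cmul, h, one_pow, one_smul]

theorem cmul_injective {Z : z} (h : Z ≠ 0) : Function.Injective (cmul Z : v →ₗ[ℝ] v) := by
  rw [injective_iff_map_eq_zero]
  intro S hS
  have h1 := cmul_cmul Z S
  rw [hS, map_zero, zero_eq_neg, smul_eq_zero] at h1
  simpa [h] using h1

variable (hv : IsOrthogonalModule z v)

include hv

theorem IsOrthogonalModule.inner_cmul_self (Z : z) (S : v) : inner ℝ (cmul Z S) S = 0 := by
  have h := hv Z S S
  rw [real_inner_comm] at h
  rw [real_inner_comm]
  linarith

theorem IsOrthogonalModule.inner_cmul_cmul (Z : z) (S T : v) :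
    inner ℝ (cmul Z S) (cmul Z T) = ‖Z‖ ^ 2 * inner ℝ S T := by
  rw [hv, cmul_cmul, inner_neg_right, neg_neg, inner_smul_right]

end Clifford

/-! ### Lower bound for the dimension of a Clifford module -/

section Words

variable {ι R : Type*} [DecidableEq ι] [Ring R]

/-- The sign picked up when the generator `a` is moved through the word `L`,
for pairwise anticommuting generators. -/
def letterSign (a : ι) (L : List ι) : ℤ :=
  (L.map fun b => if a = b then 1 else -1).prod

/-- The sign picked up when two words in pairwise anticommuting generators are interchanged. -/
def wordSign (M L : List ι) : ℤ :=
  (M.map fun a => letterSign a L).prod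

/-- The sign of the square of a word in pairwise anticommuting generators of square `-1`. -/
def squareSign : List ι → ℤ
  | [] => 1
  | a :: L => -letterSign a L * squareSign L

variable {e : ι → R} (hanti : ∀ i j, i ≠ j → e i * e j = -(e j * e i))

include hanti

theorem letter_mul_word (a : ι) (L : List ι) :
    e a * (L.map e).prod = letterSign a L • ((L.map e).prod * e a) := by
  induction L with
  | nil => simp [letterSign]
  | cons b L ih =>
    have h : e a * e b = (if a = b then (1 : ℤ) else -1) • (e b * e a) := by
      split_ifs with hab
      · rw [hab, one_smul]
      · rw [hanti a b hab, neg_one_smul]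
    simp only [List.map_cons, List.prod_cons, letterSign] at ih ⊢
    rw [← mul_assoc, h, smul_mul_assoc, mul_assoc, ih, mul_smul_comm, smul_smul, mul_assoc]

theorem word_mul_word (M L : List ι) :
    (M.map e).prod * (L.map e).prod = wordSign M L • ((L.map e).prod * (M.map e).prod) := by
  induction M with
  | nil => simp [wordSign]
  | cons a M ih =>
    simp only [List.map_cons, List.prod_cons, wordSign] at ih ⊢
    rw [mul_assoc, ih, mul_smul_comm, ← mul_assoc, letter_mul_word hanti, smul_mul_assoc,
      smul_smul, mul_assoc, mul_comm (letterSign a L)]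

theorem word_sq (hsq : ∀ i, e i * e i = -1) (L : List ι) :
    (L.map e).prod * (L.map e).prod = squareSign L • (1 : R) := by
  induction L with
  | nil => simp [squareSign]
  | cons a L ih =>
    have hs : letterSign a L * letterSign a L = 1 := by
      clear ih
      induction L with
      | nil => rfl
      | cons b L ih =>
        simp only [letterSign, List.map_cons, List.prod_cons] at ih ⊢
        rw [mul_mul_mul_comm, ih]
        split_ifs <;> rfl
    have h : (L.map e).prod * e a = letterSign a L • (e a * (L.map e).prod) := by
      rw [letter_mul_word hanti, smul_smul, hs, one_smul]
    simp only [List.map_cons, List.prod_cons, squareSign]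
    rw [mul_assoc, ← mul_assoc _ (e a), h, smul_mul_assoc, mul_smul_comm, mul_assoc (e a), ih,
      ← mul_assoc, hsq, mul_smul_comm, smul_smul, mul_one, smul_neg, neg_mul, neg_smul]

end Words

section Halving

variable {V : Type*} [AddCommGroup V] [Module ℝ V]

/-- A flip `g` anticommuting with an involution `T` embeds the `1`-eigenspace of `T` into the
`-1`-eigenspace, so the former takes up at most half of the space. -/
theorem two_mul_finrank_fixed_le [FiniteDimensional ℝ V] {W : Submodule ℝ V} {T g : Module.End ℝ V}
    (hgW : ∀ w ∈ W, g w ∈ W) (hg : Function.Injective g) (hgT : g * T = -(T * g)) :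
    2 * Module.finrank ℝ ↥(W ⊓ LinearMap.ker (T - 1)) ≤ Module.finrank ℝ W := by
  set A := W ⊓ LinearMap.ker (T - 1) with hA
  have hmem : ∀ w ∈ A, T w = w := fun w hw => by
    have := hw.2
    simpa [sub_eq_zero] using this
  have hflip : ∀ w ∈ A, T (g w) = -g w := fun w hw => by
    have h := LinearMap.congr_fun hgT w
    simp only [Module.End.mul_apply, LinearMap.neg_apply, hmem w hw] at h
    exact (neg_eq_iff_eq_neg.mpr h).symm
  have hdisj : A ⊓ A.map g = ⊥ := by
    rw [eq_bot_iff]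
    rintro _ ⟨hu, w, hw, rfl⟩
    have h1 := hmem _ hu
    rw [hflip w hw] at h1
    have h2 : (2 : ℝ) • g w = 0 := by rw [two_smul, add_eq_zero_iff_eq_neg]; exact h1.symm
    simpa using h2
  have h1 := Submodule.finrank_sup_add_finrank_inf_eq A (A.map g)
  have h2 : Module.finrank ℝ ↥(A.map g) = Module.finrank ℝ A :=
    (LinearEquiv.finrank_eq (Submodule.equivMapOfInjective g hg A)).symm
  have h3 : A ⊔ A.map g ≤ W := by
    refine sup_le inf_le_left ?_
    rintro _ ⟨w, hw, rfl⟩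
    exact hgW w hw.1
  have h4 := Submodule.finrank_mono h3
  rw [hdisj, h2, finrank_bot] at h1
  omega

/-- If `T = -1` on a vector `w`, then `T = 1` on the flipped vector `g w`. -/
theorem fixed_ne_bot {W : Submodule ℝ V} {T g : Module.End ℝ V} (hW : W ≠ ⊥)
    (hTW : ∀ w ∈ W, T w ∈ W) (hT : T * T = 1)
    (hgW : ∀ w ∈ W, g w ∈ W) (hg : Function.Injective g) (hgT : g * T = -(T * g)) :
    W ⊓ LinearMap.ker (T - 1) ≠ ⊥ := by
  obtain ⟨w, hw, hw0⟩ := W.ne_bot_iff.mp hW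
  rw [Submodule.ne_bot_iff]
  by_cases h : w + T w = 0
  · refine ⟨g w, ⟨hgW w hw, ?_⟩, fun h0 => hw0 (hg (by rw [h0, map_zero]))⟩
    have h1 := LinearMap.congr_fun hgT w
    simp only [Module.End.mul_apply, LinearMap.neg_apply] at h1
    rw [(neg_eq_of_add_eq_zero_right h).symm, map_neg, neg_inj] at h1
    rw [SetLike.mem_coe, LinearMap.mem_ker, LinearMap.sub_apply, Module.End.one_apply, ← h1, sub_self]
  · refine ⟨w + T w, ⟨W.add_mem hw (hTW w hw), ?_⟩, h⟩
    have h1 := LinearMap.congr_fun hT w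
    simp only [Module.End.mul_apply, Module.End.one_apply] at h1
    simp [h1, add_comm]

end Halving

section Bound

variable {z v : Type*} [NormedAddCommGroup z] [InnerProductSpace ℝ z]
  [NormedAddCommGroup v] [InnerProductSpace ℝ v] [FiniteDimensional ℝ v]
  [Module (CliffordAlgebra (cliffordForm z)) v]
  [IsScalarTower ℝ (CliffordAlgebra (cliffordForm z)) v]

/-- The four words of the extended Hamming code. The corresponding Clifford products are
commuting involutions. -/
def hammingWord : Fin 4 → List (Fin 8) :=
  ![[0, 1, 2, 3], [0, 1, 4, 5], [0, 2, 4, 6], [4, 5, 6, 7]]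

/-- Words whose Clifford product anticommutes with the `k`-th Hamming word and commutes with
the preceding ones. -/
def flipWord : Fin 4 → List (Fin 8) :=
  ![[0], [0, 2], [0, 1], [7]]

/-- Eight-fold periodicity: the joint `1`-eigenspace of the four involutions given by the extended
Hamming code on `e₀, …, e₇` takes up at most one sixteenth of the module, and it is a module over
the Clifford algebra of the orthogonal complement of `e₀, …, e₇`. -/
theorem exists_periodicity_submodule [Nontrivial v] {e : Fin 8 → z} (he : Orthonormal ℝ e) :
    ∃ W : Submodule ℝ v, W ≠ ⊥ ∧ 16 * Module.finrank ℝ W ≤ Module.finrank ℝ v ∧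
      ∀ Z : z, (∀ i, inner ℝ Z (e i) = 0) → ∀ w ∈ W, cmul Z w ∈ W := by
  set E : Fin 8 → Module.End ℝ v := fun i => cmul (e i) with hE
  have hanti : ∀ i j, i ≠ j → E i * E j = -(E j * E i) := fun i j hij =>
    LinearMap.ext fun S => cmul_anticomm (he.2 hij) S
  have hsq : ∀ i, E i * E i = -1 := fun i =>
    LinearMap.ext fun S => cmul_cmul_of_norm_eq_one (he.1 i) S
  have hinj : ∀ L : List (Fin 8), Function.Injective (L.map E).prod := by
    intro L
    induction L with
    | nil => exact fun _ _ h => h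
    | cons a L ih =>
      rw [List.map_cons, List.prod_cons]
      exact (cmul_injective (he.ne_zero a)).comp ih
  set T : Fin 4 → Module.End ℝ v := fun k => ((hammingWord k).map E).prod with hT
  set g : Fin 4 → Module.End ℝ v := fun k => ((flipWord k).map E).prod with hg
  have hTT : ∀ k, T k * T k = 1 := fun k => by
    rw [hT, word_sq hanti hsq, show squareSign (hammingWord k) = 1 by revert k; decide, one_smul]
  have hcomm : ∀ j k, T j * T k = T k * T j := fun j k => by
    rw [hT, word_mul_word hanti,
      show wordSign (hammingWord j) (hammingWord k) = 1 by revert j k; decide, one_smul]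
  have hgT : ∀ k, g k * T k = -(T k * g k) := fun k => by
    rw [hT, hg, word_mul_word hanti,
      show wordSign (flipWord k) (hammingWord k) = -1 by revert k; decide, neg_one_smul]
  have hgT' : ∀ k j, j < k → g k * T j = T j * g k := fun k j hjk => by
    rw [hT, hg, word_mul_word hanti,
      show wordSign (flipWord k) (hammingWord j) = 1 by revert k j; decide, one_smul]
  -- the chain of joint eigenspaces of the first `k` involutions
  have key : ∀ k : ℕ, k ≤ 4 → ∃ W : Submodule ℝ v, W ≠ ⊥ ∧
      2 ^ k * Module.finrank ℝ W ≤ Module.finrank ℝ v ∧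
      ∀ f : Module.End ℝ v, (∀ j : Fin 4, (j : ℕ) < k → f * T j = T j * f) →
        ∀ w ∈ W, f w ∈ W := by
    intro k
    induction k with
    | zero => exact fun _ => ⟨⊤, top_ne_bot, by simp, by simp⟩
    | succ k ih =>
      intro hk
      obtain ⟨W, hW, hdim, hinv⟩ := ih (by omega)
      set κ : Fin 4 := ⟨k, by omega⟩
      have hgW := hinv (g κ) fun j hj => hgT' κ j hj
      have hTW := hinv (T κ) fun j _ => hcomm κ j
      refine ⟨W ⊓ LinearMap.ker (T κ - 1),
        fixed_ne_bot hW hTW (hTT κ) hgW (hinj _) (hgT κ), ?_, ?_⟩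
      · have := two_mul_finrank_fixed_le hgW (hinj _) (hgT κ)
        rw [pow_succ, mul_assoc]
        exact (Nat.mul_le_mul_left _ this).trans hdim
      · rintro f hf w ⟨hw, hw'⟩
        refine ⟨hinv f (fun j hj => hf j (by omega)) w hw, ?_⟩
        have h1 := LinearMap.congr_fun (hf κ (by simp [κ])) w
        have h2 : T κ w = w := by simpa [sub_eq_zero] using hw'
        simp only [Module.End.mul_apply, h2] at h1
        simp [← h1]
  obtain ⟨W, hW, hdim, hinv⟩ := key 4 le_rfl
  refine ⟨W, hW, hdim, fun Z hZ => hinv (cmul Z) fun j _ => ?_⟩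
  have hZE : ∀ i, (cmul Z : Module.End ℝ v) * E i = -(E i * cmul Z) := fun i =>
    LinearMap.ext fun S => cmul_anticomm (hZ i) S
  have hZ4 : ∀ a b c d, (cmul Z : Module.End ℝ v) * (E a * (E b * (E c * (E d * 1)))) =
      (E a * (E b * (E c * (E d * 1)))) * cmul Z := by
    intro a b c d
    simp only [mul_one, mul_assoc]
    rw [← mul_assoc, hZE, neg_mul, mul_assoc, ← mul_assoc _ (E b), hZE, neg_mul, mul_assoc,
      ← mul_assoc _ (E c), hZE, neg_mul, mul_assoc, hZE]
    simp
  fin_cases j <;> exact hZ4 _ _ _ _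

/-- A subspace carrying a complex structure has even dimension. -/
theorem even_finrank_of_sq_eq_neg_one {W : Type*} [AddCommGroup W] [Module ℝ W]
    [FiniteDimensional ℝ W] (J : Module.End ℝ W) (hJ : J * J = -1) :
    Even (Module.finrank ℝ W) := by
  have h := congrArg LinearMap.det hJ
  rw [map_mul, ← neg_one_smul ℝ (1 : Module.End ℝ W), LinearMap.det_smul, map_one, mul_one] at h
  by_contra hodd
  rw [(Nat.not_even_iff_odd.mp hodd).neg_one_pow] at h
  nlinarith [mul_self_nonneg (LinearMap.det J)]

/-- The joint eigenspace `W` of `exists_periodicity_submodule` has even dimension at least `n - 7`,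
where `n = dim z`, and `dim v ≥ 16 dim W`. Evenness is needed only for `n = 10`. -/
theorem IsOrthogonalModule.finrank_bound [FiniteDimensional ℝ z] [Nontrivial v] (hv : IsOrthogonalModule z v)
    (hn : 10 ≤ Module.finrank ℝ z) :
    8 * Module.finrank ℝ z < Module.finrank ℝ v + 26 := by
  obtain ⟨m, hm⟩ : ∃ m, Module.finrank ℝ z = m + 8 := ⟨_, (Nat.sub_add_cancel (by omega)).symm⟩
  let b := stdOrthonormalBasis ℝ z
  let e : Fin 8 → z := fun i => b ⟨i, by omega⟩
  have he : Orthonormal ℝ e := b.orthonormal.comp _ fun i j h => by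
    simpa [Fin.ext_iff] using h
  obtain ⟨W, hW, hdim, hinv⟩ := exists_periodicity_submodule (v := v) he
  set Y : Submodule ℝ z := (Submodule.span ℝ (Set.range e))ᗮ with hY
  have hYe : ∀ Z ∈ Y, ∀ i, inner ℝ Z (e i) = 0 := fun Z hZ i => by
    rw [real_inner_comm]
    exact hZ _ (Submodule.subset_span ⟨i, rfl⟩)
  have hYdim : Module.finrank ℝ Y = m := by
    have h1 := Submodule.finrank_add_finrank_orthogonal (Submodule.span ℝ (Set.range e))
    rw [finrank_span_eq_card he.linearIndependent, Fintype.card_fin, hm] at h1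
    rw [hY]
    omega
  -- the vectors `s` and `Z • s`, `Z ∈ Y`, span a subspace of dimension `m + 1` of `W`
  obtain ⟨s, hs, hs0⟩ := W.ne_bot_iff.mp hW
  have hle : m + 1 ≤ Module.finrank ℝ W := by
    let A : Submodule ℝ v := Y.map (cmul.flip s)
    have hA : Module.finrank ℝ A = m := by
      rw [← hYdim]
      refine (LinearEquiv.finrank_eq (Submodule.equivMapOfInjective _ ?_ Y)).symm
      rw [injective_iff_map_eq_zero]
      intro Z hZ
      by_contra hZ0
      exact hs0 (cmul_injective hZ0 (by simpa using hZ))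
    have hlt : A < W := by
      refine lt_of_le_of_ne ?_ fun h => ?_
      · rintro _ ⟨Z, hZ, rfl⟩
        exact hinv Z (hYe Z hZ) s hs
      · obtain ⟨Z, -, hZ⟩ : s ∈ A := h ▸ hs
        have h0 := hv.inner_cmul_self Z s
        rw [LinearMap.flip_apply] at hZ
        rw [hZ] at h0
        exact hs0 (inner_self_eq_zero.mp h0)
    have := Submodule.finrank_lt_finrank_of_lt hlt
    omega
  have heven : Even (Module.finrank ℝ W) := by
    have : 0 < Module.finrank ℝ Y := by omega
    have := Module.finrank_pos_iff.mp this
    obtain ⟨Z, hZ⟩ := exists_norm_eq Y (zero_le_one (α := ℝ))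
    refine even_finrank_of_sq_eq_neg_one
      ((cmul (Z : z)).restrict (p := W) (q := W) (hinv Z (hYe Z Z.2))) ?_
    ext w
    simpa using cmul_cmul_of_norm_eq_one (v := v) (by simpa using hZ) (w : v)
  obtain ⟨r, hr⟩ := heven
  omega

end Bound

/-! ### Spinors negated by a four-dimensional volume element -/

section BadSpinors

variable {z v : Type*} [NormedAddCommGroup z] [InnerProductSpace ℝ z]
  [NormedAddCommGroup v] [InnerProductSpace ℝ v]
  [Module (CliffordAlgebra (cliffordForm z)) v]
  [IsScalarTower ℝ (CliffordAlgebra (cliffordForm z)) v]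

variable (v) in
/-- Clifford multiplication by the product `e₀ e₁ e₂ e₃`. -/
noncomputable def quad (e : Fin 4 → z) : v →ₗ[ℝ] v :=
  cmul (e 0) ∘ₗ cmul (e 1) ∘ₗ cmul (e 2) ∘ₗ cmul (e 3)

theorem quad_apply (e : Fin 4 → z) (S : v) :
    quad v e S = cmul (e 0) (cmul (e 1) (cmul (e 2) (cmul (e 3) S))) := rfl

variable (v) in
/-- The spinors on which the volume element of some oriented four-dimensional subspace
of the orthogonal complement of `x` acts as `-1`. -/
def badSpinors (x : z) : Set v :=
  {S | ∃ e : Fin 4 → z, Orthonormal ℝ e ∧ (∀ i, inner ℝ x (e i) = 0) ∧ quad v e S = -S}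

/-- A rotation of two adjacent vectors of an orthonormal frame does not change the volume
element, and it can be used to make a given linear form vanish on the second vector. -/
theorem exists_rotate_frame {e : Fin 4 → z} (he : Orthonormal ℝ e) (f : z →ₗ[ℝ] ℝ) (i : Fin 3) :
    ∃ e' : Fin 4 → z, Orthonormal ℝ e' ∧ quad v e' = quad v e ∧ f (e' i.succ) = 0 ∧
      (∀ k, k ≠ i.castSucc → k ≠ i.succ → e' k = e k) ∧
      ∀ g : z →ₗ[ℝ] ℝ, g (e i.castSucc) = 0 → g (e i.succ) = 0 →
        g (e' i.castSucc) = 0 ∧ g (e' i.succ) = 0 := by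
  obtain ⟨c, s, hcs, hf⟩ : ∃ c s : ℝ, c ^ 2 + s ^ 2 = 1 ∧
      -s * f (e i.castSucc) + c * f (e i.succ) = 0 := by
    set p := f (e i.castSucc)
    set q := f (e i.succ)
    by_cases h : p ^ 2 + q ^ 2 = 0
    · refine ⟨1, 0, by norm_num, ?_⟩
      have : q = 0 := by nlinarith [sq_nonneg p, sq_nonneg q]
      simp [this]
    · have hpos : 0 < p ^ 2 + q ^ 2 := lt_of_le_of_ne (by positivity) (Ne.symm h)
      have hr := Real.sq_sqrt hpos.le
      have hr0 := (Real.sqrt_pos.mpr hpos).ne'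
      refine ⟨p / √(p ^ 2 + q ^ 2), q / √(p ^ 2 + q ^ 2), ?_, by ring⟩
      rw [div_pow, div_pow, hr, ← add_div, div_self h]
  have hne : i.castSucc ≠ i.succ := (Fin.castSucc_lt_succ).ne
  set a := e i.castSucc with ha
  set b := e i.succ with hb
  set e' : Fin 4 → z := fun k =>
    if k = i.castSucc then c • a + s • b else if k = i.succ then -s • a + c • b else e k with he'
  have h1 : e' i.castSucc = c • a + s • b := by simp [he']
  have h2 : e' i.succ = -s • a + c • b := by simp [he', hne.symm]
  have h3 : ∀ k, k ≠ i.castSucc → k ≠ i.succ → e' k = e k := fun k hk hk' => by simp [he', hk, hk']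
  have haa : inner ℝ a a = (1 : ℝ) := by rw [real_inner_self_eq_norm_sq, he.1, one_pow]
  have hbb : inner ℝ b b = (1 : ℝ) := by rw [real_inner_self_eq_norm_sq, he.1, one_pow]
  have hab : inner ℝ a b = (0 : ℝ) := he.2 hne
  have hba : inner ℝ b a = (0 : ℝ) := he.2 hne.symm
  have hpair : ∀ S : v, cmul (e' i.castSucc) (cmul (e' i.succ) S) = cmul a (cmul b S) := fun S => by
    have hA := cmul_cmul_of_norm_eq_one (he.1 i.castSucc) S
    have hB := cmul_cmul_of_norm_eq_one (he.1 i.succ) S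
    have hBA := cmul_anticomm hba S
    rw [← ha] at hA
    rw [← hb] at hB
    rw [h1, h2]
    simp only [map_add, map_smul, LinearMap.add_apply, LinearMap.smul_apply, map_neg,
      LinearMap.neg_apply, hA, hB, hBA, neg_smul]
    calc _ = (c ^ 2 + s ^ 2) • cmul a (cmul b S) := by module
      _ = _ := by rw [hcs, one_smul]
  refine ⟨e', ?_, ?_, ?_, h3, fun g hga hgb => ?_⟩
  · have haj : ∀ k, k ≠ i.castSucc → k ≠ i.succ →
        inner ℝ a (e k) = (0 : ℝ) ∧ inner ℝ b (e k) = (0 : ℝ) :=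
      fun k hk hk' => ⟨he.2 hk.symm, he.2 hk'.symm⟩
    have hall : ∀ j k, inner ℝ (e' j) (e' k) = if j = k then (1 : ℝ) else 0 := by
      have hcc : inner ℝ (e' i.castSucc) (e' i.castSucc) = (1 : ℝ) := by
        rw [h1]
        simp only [inner_add_left, inner_add_right, inner_smul_left, inner_smul_right, haa, hbb,
          hab, hba, conj_trivial]
        linarith
      have hss : inner ℝ (e' i.succ) (e' i.succ) = (1 : ℝ) := by
        rw [h2]
        simp only [inner_add_left, inner_add_right, inner_smul_left, inner_smul_right, haa, hbb,
          hab, hba, conj_trivial]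
        linarith
      have hcs' : inner ℝ (e' i.castSucc) (e' i.succ) = (0 : ℝ) := by
        rw [h1, h2]
        simp only [inner_add_left, inner_add_right, inner_smul_left, inner_smul_right, haa, hbb,
          hab, hba, conj_trivial]
        ring
      have hck : ∀ k, k ≠ i.castSucc → k ≠ i.succ → inner ℝ (e' i.castSucc) (e' k) = (0 : ℝ) ∧
          inner ℝ (e' i.succ) (e' k) = (0 : ℝ) := fun k hk hk' => by
        rw [h1, h2, h3 k hk hk']
        simp only [inner_add_left, inner_smul_left, (haj k hk hk').1, (haj k hk hk').2, mul_zero,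
          add_zero, and_self]
      intro j k
      by_cases hj : j = i.castSucc
      · subst hj
        by_cases hk : k = i.castSucc
        · subst hk; simpa using hcc
        by_cases hk' : k = i.succ
        · subst hk'; rw [if_neg hne]; exact hcs'
        · rw [if_neg (Ne.symm hk)]; exact (hck k hk hk').1
      by_cases hj' : j = i.succ
      · subst hj'
        by_cases hk : k = i.castSucc
        · subst hk; rw [if_neg hne.symm, real_inner_comm]; exact hcs'
        by_cases hk' : k = i.succ
        · subst hk'; simpa using hss
        · rw [if_neg (Ne.symm hk')]; exact (hck k hk hk').2
      by_cases hk : k = i.castSucc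
      · subst hk; rw [if_neg hj, real_inner_comm]; exact (hck j hj hj').1
      by_cases hk' : k = i.succ
      · subst hk'; rw [if_neg hj', real_inner_comm]; exact (hck j hj hj').2
      · rw [h3 j hj hj', h3 k hk hk']
        exact (orthonormal_iff_ite.mp he) j k
    exact orthonormal_iff_ite.mpr hall
  · ext S
    rw [quad_apply, quad_apply]
    fin_cases i
    · have h4 : e' 2 = e 2 := h3 2 (by decide) (by decide)
      have h5 : e' 3 = e 3 := h3 3 (by decide) (by decide)
      rw [h4, h5]
      exact hpair _
    · have h4 : e' 0 = e 0 := h3 0 (by decide) (by decide)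
      have h5 : e' 3 = e 3 := h3 3 (by decide) (by decide)
      rw [h4, h5]
      exact congrArg _ (hpair _)
    · have h4 : e' 0 = e 0 := h3 0 (by decide) (by decide)
      have h5 : e' 1 = e 1 := h3 1 (by decide) (by decide)
      rw [h4, h5]
      exact congrArg _ (congrArg _ (hpair _))
  · rw [h2, map_add, map_smul, map_smul]
    exact hf
  · rw [h1, h2]
    simp [hga, hgb]

/-- The volume element of a four-dimensional subspace can be written with an orthonormal frame in
echelon form with respect to three given linear forms. -/
theorem exists_echelon_frame {e : Fin 4 → z} (he : Orthonormal ℝ e) (f : Fin 3 → z →ₗ[ℝ] ℝ) :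
    ∃ e' : Fin 4 → z, Orthonormal ℝ e' ∧ quad v e' = quad v e ∧
      (∀ (i : Fin 3) (j : Fin 4), i.castSucc < j → f i (e' j) = 0) ∧
      ∀ g : z →ₗ[ℝ] ℝ, (∀ i, g (e i) = 0) → ∀ i, g (e' i) = 0 := by
  have hg : ∀ {e e' : Fin 4 → z} (i : Fin 3),
      (∀ k, k ≠ i.castSucc → k ≠ i.succ → e' k = e k) →
      (∀ g : z →ₗ[ℝ] ℝ, g (e i.castSucc) = 0 → g (e i.succ) = 0 →
        g (e' i.castSucc) = 0 ∧ g (e' i.succ) = 0) →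
      ∀ g : z →ₗ[ℝ] ℝ, (∀ i, g (e i) = 0) → ∀ i, g (e' i) = 0 := by
    intro e e' i h1 h2 g hg k
    have := h2 g (hg _) (hg _)
    by_cases hk : k = i.castSucc
    · rw [hk]; exact this.1
    by_cases hk' : k = i.succ
    · rw [hk']; exact this.2
    · rw [h1 k hk hk']; exact hg k
  obtain ⟨a, ha, qa, fa, ka, ga⟩ := exists_rotate_frame (v := v) he (f 0) 2
  obtain ⟨b, hb, qb, fb, kb, gb⟩ := exists_rotate_frame (v := v) ha (f 0) 1
  obtain ⟨c, hc, qc, fc, kc, gc⟩ := exists_rotate_frame (v := v) hb (f 0) 0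
  obtain ⟨d, hd, qd, fd, kd, gd⟩ := exists_rotate_frame (v := v) hc (f 1) 2
  obtain ⟨p, hp, qp, fp, kp, gp⟩ := exists_rotate_frame (v := v) hd (f 1) 1
  obtain ⟨q, hq, qq, fq, kq, gq⟩ := exists_rotate_frame (v := v) hp (f 2) 2
  refine ⟨q, hq, by rw [qq, qp, qd, qc, qb, qa], ?_, fun g h =>
    hg 2 kq gq g <| hg 1 kp gp g <| hg 2 kd gd g <| hg 0 kc gc g <| hg 1 kb gb g <|
      hg 2 ka ga g h⟩
  change f 0 (a 3) = 0 at fa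
  change f 0 (b 2) = 0 at fb
  change f 0 (c 1) = 0 at fc
  change f 1 (d 3) = 0 at fd
  change f 1 (p 2) = 0 at fp
  change f 2 (q 3) = 0 at fq
  have b3 : b 3 = a 3 := kb 3 (by decide) (by decide)
  have c2 : c 2 = b 2 := kc 2 (by decide) (by decide)
  have c3 : c 3 = b 3 := kc 3 (by decide) (by decide)
  have d1 : d 1 = c 1 := kd 1 (by decide) (by decide)
  have p3 : p 3 = d 3 := kp 3 (by decide) (by decide)
  have q1 : q 1 = p 1 := kq 1 (by decide) (by decide)
  have d23 := gd (f 0) (by change f 0 (c 2) = 0; rw [c2, fb])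
    (by change f 0 (c 3) = 0; rw [c3, b3, fa])
  have p12 := gp (f 0) (by change f 0 (d 1) = 0; rw [d1, fc]) d23.1
  have p3' : f 0 (p 3) = 0 := by rw [p3]; exact d23.2
  have q23 := gq (f 0) p12.2 p3'
  have q23' := gq (f 1) fp (by change f 1 (p 3) = 0; rw [p3, fd])
  have q1' : f 0 (q 1) = 0 := by rw [q1]; exact p12.1
  intro i j hij
  fin_cases i <;> fin_cases j <;> first | exact absurd hij (by decide) | skip
  · exact q1'
  · exact q23.1
  · exact q23.2
  · exact q23'.1
  · exact q23'.2
  · exact fq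

/-- `1 - e₀ e₁ e₂ e₃` is twice a projection, of rank half the dimension as `e₀` anticommutes with
the volume element. -/
theorem two_mul_finrank_range_sub_quad_le [FiniteDimensional ℝ v] {e : Fin 4 → z}
    (he : Orthonormal ℝ e) :
    2 * Module.finrank ℝ (LinearMap.range (1 - quad v e : Module.End ℝ v)) ≤
      Module.finrank ℝ v := by
  have hsq : ∀ i (S : v), cmul (e i) (cmul (e i) S) = -S := fun i S =>
    cmul_cmul_of_norm_eq_one (he.1 i) S
  have hac : ∀ i j (_ : j < i) (S : v), cmul (e i) (cmul (e j) S) = -cmul (e j) (cmul (e i) S) :=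
    fun i j hij S => cmul_anticomm (he.2 hij.ne') S
  have hQ : ∀ S : v, quad v e (quad v e S) = S := fun S => by
    simp only [quad_apply, hac 3 0 (by decide), hac 3 1 (by decide), hac 3 2 (by decide),
      hac 2 0 (by decide), hac 2 1 (by decide), hac 1 0 (by decide), hsq, map_neg, neg_neg]
  have hg : (cmul (e 0) : Module.End ℝ v) * (-quad v e) = -((-quad v e) * cmul (e 0)) := by
    ext S
    simp only [Module.End.mul_apply, LinearMap.neg_apply, map_neg, quad_apply,
      hac 3 0 (by decide), hac 2 0 (by decide), hac 1 0 (by decide), hsq, neg_neg]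
  have h := two_mul_finrank_fixed_le (W := ⊤) (T := -quad v e) (fun _ _ => Submodule.mem_top)
    (cmul_injective (he.ne_zero 0)) hg
  rw [top_inf_eq, finrank_top] at h
  refine (Nat.mul_le_mul_left 2 (Submodule.finrank_mono ?_)).trans h
  rintro _ ⟨S, rfl⟩
  simp [hQ]

end BadSpinors

section BadSpinorsDense

variable {z v : Type*} [NormedAddCommGroup z] [InnerProductSpace ℝ z]
  [NormedAddCommGroup v] [InnerProductSpace ℝ v]

/-- The affine map parametrizing the vectors with coordinates supported in `insert p s`
and `p`-th coordinate `1`. -/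
noncomputable def affineChart {n : ℕ} (b : OrthonormalBasis (Fin n) ℝ z) (p : Fin n) (s : Finset (Fin n))
    (y : s → ℝ) : z :=
  b p + ∑ i, y i • b i

theorem contDiff_affineChart {n : ℕ} (b : OrthonormalBasis (Fin n) ℝ z) (p : Fin n)
    (s : Finset (Fin n)) : ContDiff ℝ 1 (affineChart b p s) := by
  unfold affineChart
  fun_prop

theorem sum_subtype_of_inner_eq_zero {n : ℕ} (b : OrthonormalBasis (Fin n) ℝ z) {s : Finset (Fin n)}
    {e : z} (h : ∀ i, i ∉ s → inner ℝ (b i) e = 0) :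
    ∑ i : s, inner ℝ (b i) e • b (i : Fin n) = e := by
  rw [Finset.sum_coe_sort s fun i => inner ℝ (b i) e • b i]
  nth_rewrite 2 [← b.sum_repr' e]
  exact Finset.sum_subset (Finset.subset_univ s) fun i _ hi => by rw [h i hi, zero_smul]

theorem exists_eq_smul_affineChart {n : ℕ} (b : OrthonormalBasis (Fin n) ℝ z) {s : Finset (Fin n)}
    {e : z} (he : e ≠ 0) (h : ∀ i, i ∉ s → inner ℝ (b i) e = 0) :
    ∃ p ∈ s, ∃ (r : ℝ) (y : s.erase p → ℝ), e = r • affineChart b p (s.erase p) y := by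
  obtain ⟨p, hp⟩ : ∃ p, inner ℝ (b p) e ≠ 0 := by
    by_contra! h0
    exact he (by rw [← b.sum_repr' e]; simp [h0])
  have hps : p ∈ s := by
    by_contra hps
    exact hp (h p hps)
  refine ⟨p, hps, inner ℝ (b p) e, fun i => inner ℝ (b i) e / inner ℝ (b p) e, ?_⟩
  have h1 := sum_subtype_of_inner_eq_zero b h
  rw [Finset.sum_coe_sort s fun i => inner ℝ (b i) e • b i, ← Finset.add_sum_erase s _ hps,
    ← Finset.sum_coe_sort] at h1
  rw [affineChart, smul_add, Finset.smul_sum]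
  simp only [smul_smul, mul_div_cancel₀ _ hp]
  exact h1.symm

variable [Module (CliffordAlgebra (cliffordForm z)) v]
  [IsScalarTower ℝ (CliffordAlgebra (cliffordForm z)) v]

/-- The parametrization of a piece of `badSpinors`: it sends a frame in echelon form (normalized in
all but the first vector) and a spinor `T` in the span of `β` to `T - e₀ e₁ e₂ e₃ T`. -/
noncomputable def badSpinorChart {n r : ℕ} (b : OrthonormalBasis (Fin n) ℝ z) (s : Finset (Fin n))
    (p : Fin 3 → Fin n) (t : Fin 3 → Finset (Fin n)) (β : Fin r → v)
    (y : (s → ℝ) × (t 0 → ℝ) × (t 1 → ℝ) × (t 2 → ℝ) × (Fin r → ℝ)) : v :=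
  (1 - quad v ![∑ i, y.1 i • b (i : Fin n), affineChart b (p 0) (t 0) y.2.1,
    affineChart b (p 1) (t 1) y.2.2.1, affineChart b (p 2) (t 2) y.2.2.2.1] : Module.End ℝ v)
    (∑ k, y.2.2.2.2 k • β k)

variable [FiniteDimensional ℝ z] [FiniteDimensional ℝ v]

theorem contDiff_badSpinorChart {n r : ℕ} (b : OrthonormalBasis (Fin n) ℝ z) (s : Finset (Fin n))
    (p : Fin 3 → Fin n) (t : Fin 3 → Finset (Fin n)) (β : Fin r → v) :
    ContDiff ℝ 1 (badSpinorChart b s p t β) := by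
  have hc : ∀ (Z : z) (S : v), cmul Z S = (cmul : z →ₗ[ℝ] v →ₗ[ℝ] v).toContinuousBilinearMap Z S :=
    fun Z S => (LinearMap.toContinuousBilinearMap_apply _ _ _).symm
  have h0 := contDiff_affineChart b (p 0) (t 0)
  have h1 := contDiff_affineChart b (p 1) (t 1)
  have h2 := contDiff_affineChart b (p 2) (t 2)
  unfold badSpinorChart
  simp only [LinearMap.sub_apply, Module.End.one_apply, quad_apply, Matrix.cons_val, hc]
  fun_prop

/-- If `dim v > 8 dim z - 26`, then `badSpinors x` is contained in a finite union of images of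
smooth maps from spaces of dimension less than `dim v`, so its complement is dense. -/
theorem dense_compl_badSpinors {x : z} (hx : x ≠ 0) (hn : 5 ≤ Module.finrank ℝ z)
    (hdim : 8 * Module.finrank ℝ z < Module.finrank ℝ v + 26) :
    Dense (badSpinors v x)ᶜ := by
  obtain ⟨d, hd⟩ : ∃ d, Module.finrank ℝ z = d + 5 := ⟨_, (Nat.sub_add_cancel hn).symm⟩
  -- an orthonormal basis whose first vector is proportional to `x`
  obtain ⟨b, hb⟩ : ∃ b : OrthonormalBasis (Fin (d + 5)) ℝ z, x = ‖x‖ • b 0 := by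
    have h1 : Orthonormal ℝ (({0} : Set (Fin (d + 5))).domRestrict fun _ => ‖x‖⁻¹ • x) := by
      refine ⟨fun i => ?_, fun i j hij => absurd (Subsingleton.elim i j) hij⟩
      change ‖‖x‖⁻¹ • x‖ = 1
      rw [norm_smul, norm_inv, norm_norm, inv_mul_cancel₀ (norm_ne_zero_iff.mpr hx)]
    obtain ⟨b, hb⟩ := h1.exists_orthonormalBasis_extension_of_card_eq (by simp [hd])
    refine ⟨b, ?_⟩
    rw [hb 0 rfl, smul_smul, mul_inv_cancel₀ (norm_ne_zero_iff.mpr hx), one_smul]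
  let B := Module.finBasis ℝ v
  -- the support of the `j`-th vector of an echelon frame
  let s : Fin 4 → Finset (Fin (d + 5)) := fun j => Finset.Ioi ⟨j, by omega⟩
  have hcover : badSpinors v x ⊆ ⋃ (p : {p : Fin 3 → Fin (d + 5) // ∀ j, p j ∈ s j.succ}) (r : ℕ)
      (κ : {κ : Fin r → Fin (Module.finrank ℝ v) // 2 * r ≤ Module.finrank ℝ v}),
      Set.range (badSpinorChart b (s 0) p.1 (fun j => (s j.succ).erase (p.1 j)) (B ∘ κ.1)) := by
    rintro S ⟨e₀, he₀, hxe₀, hS⟩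
    obtain ⟨e, he, hq, hech, hg⟩ := exists_echelon_frame (v := v) he₀
      fun i => innerₗ z (b ⟨i + 1, by omega⟩)
    rw [← hq] at hS
    have hxe : ∀ j, inner ℝ (b 0) (e j) = 0 := by
      intro j
      have := hg (innerₗ z x) hxe₀ j
      rw [innerₗ_apply_apply, hb, inner_smul_left] at this
      simpa [hx] using this
    have hsupp : ∀ j i, i ∉ s j → inner ℝ (b i) (e j) = 0 := by
      intro j i hi
      have hij : (i : ℕ) ≤ j := by simpa [s, Fin.le_def] using hi
      rcases Nat.eq_zero_or_pos (i : ℕ) with h0 | h0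
      · rw [show i = 0 from Fin.ext h0]; exact hxe j
      · have := hech ⟨i - 1, by omega⟩ j (by rw [Fin.lt_def]; simp; omega)
        simpa [Nat.sub_add_cancel h0] using this
    choose p hp ρ y hy using fun j : Fin 3 =>
      exists_eq_smul_affineChart b (he.ne_zero j.succ) (hsupp j.succ)
    set P : Module.End ℝ v := 1 - quad v e with hP
    obtain ⟨f, hf, hspan, -⟩ := Submodule.exists_fun_fin_finrank_span_eq ℝ (Set.range (P ∘ B))
    have hrange : Submodule.span ℝ (Set.range (P ∘ B)) = LinearMap.range P := by
      rw [Set.range_comp, ← Submodule.map_span, B.span_eq, Submodule.map_top]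
    choose κ hκ using hf
    have hr : 2 * Module.finrank ℝ ↥(Submodule.span ℝ (Set.range (P ∘ B))) ≤
        Module.finrank ℝ v := by
      rw [hrange]
      exact two_mul_finrank_range_sub_quad_le he
    have hmem : S ∈ Submodule.span ℝ (Set.range f) := by
      rw [hspan, hrange]
      refine ⟨(2⁻¹ : ℝ) • S, ?_⟩
      rw [map_smul, hP, LinearMap.sub_apply, hS, Module.End.one_apply, sub_neg_eq_add, ← two_smul ℝ,
        smul_smul, inv_mul_cancel₀ two_ne_zero, one_smul]
    obtain ⟨t, ht⟩ := (Submodule.mem_span_range_iff_exists_fun ℝ).mp hmem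
    simp only [Set.mem_iUnion]
    refine ⟨⟨p, hp⟩, _, ⟨κ, hr⟩,
      (fun i => ρ 0 * ρ 1 * ρ 2 * inner ℝ (b i) (e 0), y 0, y 1, y 2, t), ?_⟩
    have he0 : ∑ i : s 0, (ρ 0 * ρ 1 * ρ 2 * inner ℝ (b i) (e 0)) • b (i : Fin (d + 5)) =
        (ρ 0 * ρ 1 * ρ 2) • e 0 := by
      simp only [mul_smul (ρ 0 * ρ 1 * ρ 2)]
      rw [← Finset.smul_sum, sum_subtype_of_inner_eq_zero b (hsupp 0)]
    have hquad : quad v ![(ρ 0 * ρ 1 * ρ 2) • e 0, affineChart b (p 0) ((s 1).erase (p 0)) (y 0),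
        affineChart b (p 1) ((s 2).erase (p 1)) (y 1),
        affineChart b (p 2) ((s 3).erase (p 2)) (y 2)] = quad v e := by
      ext T
      have h1 : e 1 = _ := hy 0
      have h2 : e 2 = _ := hy 1
      have h3 : e 3 = _ := hy 2
      rw [quad_apply, quad_apply, h1, h2, h3]
      simp only [Matrix.cons_val, map_smul, LinearMap.smul_apply, smul_smul]
      congr 1
      ring
    change (1 - quad v ![∑ i : s 0, (ρ 0 * ρ 1 * ρ 2 * inner ℝ (b i) (e 0)) • b (i : Fin (d + 5)),
        affineChart b (p 0) ((s 1).erase (p 0)) (y 0),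
        affineChart b (p 1) ((s 2).erase (p 1)) (y 1),
        affineChart b (p 2) ((s 3).erase (p 2)) (y 2)] : Module.End ℝ v)
        (∑ k, t k • B (κ k)) = S
    rw [he0, hquad, ← hP, map_sum, ← ht]
    exact Finset.sum_congr rfl fun k _ => by rw [map_smul, ← hκ k]; rfl
  refine dense_compl_of_dimH_lt_finrank ((dimH_mono hcover).trans_lt ?_)
  have hlt : ((4 * d + 7 + Module.finrank ℝ v / 2 : ℕ) : ENNReal) < Module.finrank ℝ v := by
    rw [Nat.cast_lt]
    omega
  refine lt_of_le_of_lt ?_ hlt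
  simp only [dimH_iUnion]
  refine iSup_le fun p => iSup_le fun r => iSup_le fun κ => ?_
  refine (contDiff_badSpinorChart b _ _ _ _).dimH_range_le.trans ?_
  rw [Nat.cast_le]
  have hcard : ∀ j, (s j).card = d + 4 - j := fun j => by simp [s]
  have h0 := hcard 0
  have h1 := Finset.card_erase_of_mem (p.2 0)
  have h2 := Finset.card_erase_of_mem (p.2 1)
  have h3 := Finset.card_erase_of_mem (p.2 2)
  rw [hcard] at h1 h2 h3
  simp only [Module.finrank_prod, Module.finrank_fintype_fun_eq_card, Fintype.card_coe,
    Fintype.card_fin]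
  have h4 := κ.2
  rw [h0, h1, h2, h3]
  simp
  omega

end BadSpinorsDense

/-! ### Spectra of symmetric operators and their perturbation -/

section Spectrum

open Module.End Polynomial

variable {E : Type*} [NormedAddCommGroup E] [InnerProductSpace ℝ E] [FiniteDimensional ℝ E]

/-- The number of distinct real eigenvalues of an endomorphism. -/
noncomputable def eigenCount (A : Module.End ℝ E) : ℕ :=
  {c : ℝ | A.HasEigenvalue c}.ncard

/-- The finite set of real eigenvalues of an endomorphism. -/
noncomputable def eigenFinset (A : Module.End ℝ E) : Finset ℝ :=
  (finite_hasEigenvalue A).toFinset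

theorem mem_eigenFinset {A : Module.End ℝ E} {c : ℝ} : c ∈ eigenFinset A ↔ A.HasEigenvalue c := by
  simp [eigenFinset]

theorem card_eigenFinset (A : Module.End ℝ E) : (eigenFinset A).card = eigenCount A :=
  (Set.ncard_eq_toFinset_card _ _).symm

/-- The product of the linear factors `X - c` over the distinct eigenvalues `c`. It is the minimal
polynomial of a symmetric operator. -/
noncomputable def eigenPoly (A : Module.End ℝ E) : ℝ[X] :=
  ∏ c ∈ eigenFinset A, (X - C c)

theorem eigenPoly_monic (A : Module.End ℝ E) : (eigenPoly A).Monic :=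
  monic_prod_of_monic _ _ fun c _ => monic_X_sub_C c

theorem degree_eigenPoly (A : Module.End ℝ E) : (eigenPoly A).degree = eigenCount A := by
  rw [eigenPoly, degree_prod, Finset.sum_congr rfl fun c _ => degree_X_sub_C c]
  simp [card_eigenFinset]

theorem aeval_eigenPoly {A : Module.End ℝ E} (hA : A.IsSymmetric) : aeval A (eigenPoly A) = 0 := by
  have htop : ⨆ c, eigenspace A c = ⊤ :=
    Submodule.orthogonal_eq_bot_iff.mp hA.orthogonalComplement_iSup_eigenspaces_eq_bot
  rw [← LinearMap.ker_eq_top, eq_top_iff, ← htop]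
  refine iSup_le fun c u hu => ?_
  rw [LinearMap.mem_ker, aeval_apply_of_mem_apply_eq_smul (mem_eigenspace_iff.mp hu)]
  by_cases hc : A.HasEigenvalue c
  · rw [eigenPoly, eval_prod, Finset.prod_eq_zero (mem_eigenFinset.mpr hc) (by simp), zero_smul]
  · rw [show u = 0 from (Submodule.eq_bot_iff _).mp (not_not.mp hc) u hu, smul_zero]

theorem eval_derivative_eigenPoly_ne_zero {A : Module.End ℝ E} {c : ℝ} (hc : A.HasEigenvalue c) :
    (derivative (eigenPoly A)).eval c ≠ 0 := by
  rw [eigenPoly, ← Finset.mul_prod_erase _ _ (mem_eigenFinset.mpr hc), derivative_mul]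
  simp only [derivative_sub, derivative_X, derivative_C, sub_zero, one_mul, eval_add, eval_mul,
    eval_sub, eval_X, eval_C, sub_self, zero_mul, add_zero, eval_prod]
  exact Finset.prod_ne_zero_iff.mpr fun d hd => sub_ne_zero.mpr (Finset.ne_of_mem_erase hd).symm

theorem linearIndependent_pow_eigenCount (A : Module.End ℝ E) :
    LinearIndependent ℝ fun i : Fin (eigenCount A) => A ^ (i : ℕ) := by
  rw [Fintype.linearIndependent_iff]
  intro g hg
  set P : ℝ[X] := ∑ i : Fin (eigenCount A), monomial (i : ℕ) (g i) with hP
  have hPA : aeval A P = 0 := by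
    rw [hP, map_sum, ← hg]
    exact Finset.sum_congr rfl fun i _ => by rw [aeval_monomial, Algebra.smul_def]
  have hdeg : P.degree < (eigenFinset A).card := by
    rw [card_eigenFinset, ← mem_degreeLT]
    exact Submodule.sum_mem _ fun i _ => monomial_coe_mem_degreeLT i (g i)
  have hP0 : P = 0 := by
    refine eq_zero_of_degree_lt_of_eval_finset_eq_zero _ hdeg fun c hc => ?_
    obtain ⟨u, hu⟩ := (mem_eigenFinset.mp hc).exists_hasEigenvector
    have h := aeval_apply_of_hasEigenvector (p := P) hu
    rw [hPA, LinearMap.zero_apply] at h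
    exact (smul_eq_zero.mp h.symm).resolve_right hu.2
  intro i
  have h := congrArg (fun Q => coeff Q (i : ℕ)) hP0
  simpa [hP, coeff_monomial, Fin.val_inj] using h

theorem le_eigenCount_of_linearIndependent {A : Module.End ℝ E} (hA : A.IsSymmetric) {r : ℕ}
    {p : Fin r → ℝ[X]} (h : LinearIndependent ℝ fun i => aeval A (p i)) : r ≤ eigenCount A := by
  set M : Submodule ℝ (Module.End ℝ E) :=
    (degreeLT ℝ (eigenCount A)).map (aeval A).toLinearMap with hM
  have hMdim : Module.finrank ℝ M ≤ eigenCount A := by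
    have : FiniteDimensional ℝ (degreeLT ℝ (eigenCount A)) :=
      (degreeLTEquiv ℝ (eigenCount A)).symm.finiteDimensional
    refine (Submodule.finrank_map_le _ _).trans ?_
    rw [(degreeLTEquiv ℝ (eigenCount A)).finrank_eq, Module.finrank_fin_fun]
  have hmem : ∀ i, aeval A (p i) ∈ M := fun i => by
    refine ⟨p i %ₘ eigenPoly A, ?_, aeval_modByMonic_eq_self_of_root (aeval_eigenPoly hA)⟩
    rw [SetLike.mem_coe, mem_degreeLT, ← degree_eigenPoly]
    exact degree_modByMonic_lt _ (eigenPoly_monic A)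
  have h1 : LinearIndependent ℝ fun i => (⟨aeval A (p i), hmem i⟩ : M) :=
    LinearIndependent.of_comp M.subtype h
  simpa using h1.fintype_card_le_finrank.trans hMdim

theorem sum_finrank_eigenspace {A : Module.End ℝ E} (hA : A.IsSymmetric) :
    ∑ c ∈ eigenFinset A, Module.finrank ℝ (eigenspace A c) = Module.finrank ℝ E := by
  classical
  have h := LinearEquiv.ofBijective
    (DirectSum.coeLinearMap fun μ : Eigenvalues A => eigenspace A μ) hA.direct_sum_isInternal
  rw [← h.finrank_eq, Module.finrank_directSum]
  refine Finset.sum_bij' (fun c hc => ⟨c, mem_eigenFinset.mp hc⟩) (fun c _ => c.1) ?_ ?_ ?_ ?_ ?_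
  · exact fun _ _ => Finset.mem_univ _
  · exact fun c _ => mem_eigenFinset.mpr c.2
  · exact fun _ _ => rfl
  · exact fun _ _ => rfl
  · exact fun _ _ => rfl

/-- Compressed to an eigenspace of `A 0` for `μ`, the derivative of `q(A t)` at `t = 0` is `q'(μ)` times
the derivative of `A t`. -/
theorem exists_hasDerivAt_aeval {A : ℝ → Module.End ℝ E} {A' : Module.End ℝ E}
    (hA0 : (A 0).IsSymmetric)
    (hA : HasDerivAt (fun t => Module.End.toContinuousLinearMap E (A t))
      (Module.End.toContinuousLinearMap E A') 0) (q : ℝ[X]) (μ : ℝ) :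
    ∃ B : Module.End ℝ E, HasDerivAt (fun t => Module.End.toContinuousLinearMap E (aeval (A t) q))
      (Module.End.toContinuousLinearMap E B) 0 ∧
      ∀ u ∈ eigenspace (A 0) μ, ∀ w ∈ eigenspace (A 0) μ,
        inner ℝ (B u) w = (derivative q).eval μ * inner ℝ (A' u) w := by
  induction q using Polynomial.induction_on' with
  | add p q hp hq =>
    obtain ⟨B, hB, hB'⟩ := hp
    obtain ⟨D, hD, hD'⟩ := hq
    refine ⟨B + D, ?_, fun u hu w hw => ?_⟩
    · simp only [map_add]
      exact hB.add hD
    · rw [LinearMap.add_apply, inner_add_left, hB' u hu w hw, hD' u hu w hw, derivative_add,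
        eval_add, add_mul]
  | monomial n a =>
    induction n with
    | zero =>
      refine ⟨0, ?_, by simp⟩
      simp only [monomial_zero_left, aeval_C, map_zero]
      exact hasDerivAt_const _ _
    | succ n ih =>
      obtain ⟨B, hB, hB'⟩ := ih
      rw [← X_mul_monomial]
      refine ⟨A' * aeval (A 0) (monomial n a) + A 0 * B, ?_, fun u hu w hw => ?_⟩
      · simp only [map_mul, aeval_X, map_add]
        exact hA.mul hB
      · rw [LinearMap.add_apply, Module.End.mul_apply, Module.End.mul_apply,
          aeval_apply_of_mem_apply_eq_smul (mem_eigenspace_iff.mp hu), inner_add_left, hA0,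
          mem_eigenspace_iff.mp hw, inner_smul_right, hB' u hu w hw, map_smul, inner_smul_left,
          derivative_mul, derivative_X, one_mul, eval_add, eval_mul, eval_X, conj_trivial]
        ring

/-- First-order perturbation theory: if the number of distinct eigenvalues of a differentiable
family of symmetric operators does not increase near `t = 0`, then the compression of the derivative
to each eigenspace is a scalar. Otherwise the limit of `q(A t) / t`, where `q` is the
minimal polynomial of `A 0`, would be linearly independent of the powers of `A 0`. -/
theorem exists_compression_eq_smul {A : ℝ → Module.End ℝ E} {A' : Module.End ℝ E}
    (hsymm : ∀ t, (A t).IsSymmetric)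
    (hA : HasDerivAt (fun t => Module.End.toContinuousLinearMap E (A t))
      (Module.End.toContinuousLinearMap E A') 0)
    (hcount : ∀ᶠ t in 𝓝 0, eigenCount (A t) ≤ eigenCount (A 0)) (μ : ℝ) :
    ∃ s : ℝ, ∀ u ∈ eigenspace (A 0) μ, ∀ w ∈ eigenspace (A 0) μ,
      inner ℝ (A' u) w = s * inner ℝ u w := by
  by_cases hμ : (A 0).HasEigenvalue μ
  swap
  · refine ⟨0, fun u hu w _ => ?_⟩
    rw [show u = 0 from (Submodule.eq_bot_iff _).mp (not_not.mp hμ) u hu]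
    simp
  set φ := Module.End.toContinuousLinearMap (𝕜 := ℝ) E
  have hφ : LinearMap.ker φ.toLinearMap = ⊥ := LinearMap.ker_eq_bot.mpr φ.injective
  set k := eigenCount (A 0) with hk
  set q := eigenPoly (A 0) with hq
  obtain ⟨B, hB, hB'⟩ := exists_hasDerivAt_aeval (hsymm 0) hA q μ
  have hpow : ∀ i : ℕ, Filter.Tendsto (fun t => φ (A t ^ i)) (𝓝[≠] 0) (𝓝 (φ (A 0 ^ i))) := by
    intro i
    simp only [map_pow]
    exact ((hA.continuousAt.pow i).tendsto).mono_left nhdsWithin_le_nhds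
  have hslope : Filter.Tendsto (fun t : ℝ => t⁻¹ • φ (aeval (A t) q)) (𝓝[≠] 0) (𝓝 (φ B)) := by
    have h := hB.tendsto_slope
    refine h.congr fun t => ?_
    rw [slope_def_module, hq, aeval_eigenPoly (hsymm 0), map_zero, sub_zero, sub_zero]
  have hdep : ¬ LinearIndependent ℝ
      (Fin.snoc (fun i : Fin k => φ (A 0 ^ (i : ℕ))) (φ B) : Fin (k + 1) → E →L[ℝ] E) := by
    intro hind
    have htend : Filter.Tendsto (fun t : ℝ => (Fin.snoc (fun i : Fin k => φ (A t ^ (i : ℕ)))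
        (t⁻¹ • φ (aeval (A t) q)) : Fin (k + 1) → E →L[ℝ] E)) (𝓝[≠] 0)
        (𝓝 (Fin.snoc (fun i : Fin k => φ (A 0 ^ (i : ℕ))) (φ B))) := by
      rw [tendsto_pi_nhds]
      intro j
      refine Fin.lastCases ?_ (fun i => ?_) j
      · simpa using hslope
      · simpa using hpow i
    have hev := htend.eventually hind.eventually
    obtain ⟨t, ht, ht'⟩ := (hev.and (hcount.filter_mono nhdsWithin_le_nhds)).exists
    refine absurd ht' (not_le.mpr (Nat.lt_of_succ_le ?_))
    refine le_eigenCount_of_linearIndependent (hsymm t)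
      (p := (Fin.snoc (fun i : Fin k => (X : ℝ[X]) ^ (i : ℕ)) (t⁻¹ • q) : Fin (k + 1) → ℝ[X])) ?_
    refine LinearIndependent.of_comp φ.toLinearMap ?_
    have hfun : (φ.toLinearMap ∘ fun j => aeval (A t)
        ((Fin.snoc (fun i : Fin k => (X : ℝ[X]) ^ (i : ℕ)) (t⁻¹ • q) : Fin (k + 1) → ℝ[X]) j)) =
        Fin.snoc (fun i : Fin k => φ (A t ^ (i : ℕ))) (t⁻¹ • φ (aeval (A t) q)) := by
      funext j
      refine Fin.lastCases ?_ (fun i => ?_) j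
      · simp
      · simp
    rw [hfun]
    exact ht
  have hpowind : LinearIndependent ℝ fun i : Fin k => φ (A 0 ^ (i : ℕ)) :=
    (linearIndependent_pow_eigenCount (A 0)).map' φ.toLinearMap hφ
  rw [linearIndependent_finSnoc, not_and, not_not] at hdep
  obtain ⟨g, hg⟩ := (Submodule.mem_span_range_iff_exists_fun ℝ).mp (hdep hpowind)
  have hBg : B = ∑ i, g i • A 0 ^ (i : ℕ) := φ.injective (by rw [← hg]; simp)
  have hne := eval_derivative_eigenPoly_ne_zero hμ
  refine ⟨(∑ i, g i * μ ^ (i : ℕ)) / (derivative q).eval μ, fun u hu w hw => ?_⟩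
  have hpu : ∀ i : ℕ, (A 0 ^ i) u = μ ^ i • u := fun i => by
    have := aeval_apply_of_mem_apply_eq_smul (p := (X : ℝ[X]) ^ i) (mem_eigenspace_iff.mp hu)
    simpa using this
  have h := hB' u hu w hw
  rw [hBg] at h
  simp only [LinearMap.sum_apply, LinearMap.smul_apply, hpu, smul_smul] at h
  rw [← Finset.sum_smul, inner_smul_left, conj_trivial] at h
  rw [div_mul_eq_mul_div, h, mul_comm, mul_div_cancel_right₀ _ hne]

end Spectrum

/-! ### Eigenspaces of the negative square of a skew-symmetric operator -/

section Skew

open Module.End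

variable {E : Type*} [NormedAddCommGroup E] [InnerProductSpace ℝ E] {K : Module.End ℝ E}
  (hK : ∀ u w, inner ℝ (K u) w = -inner ℝ u (K w))

include hK

theorem inner_neg_sq_of_skew (u w : E) : inner ℝ ((-(K * K)) u) w = inner ℝ (K u) (K w) := by
  rw [LinearMap.neg_apply, Module.End.mul_apply, inner_neg_left, hK, neg_neg]

theorem isSymmetric_neg_sq_of_skew : (-(K * K)).IsSymmetric := fun u w => by
  rw [inner_neg_sq_of_skew hK, real_inner_comm _ u, inner_neg_sq_of_skew hK, real_inner_comm]

theorem pos_of_hasEigenvalue_neg_sq {μ : ℝ} (hμ : μ ≠ 0) (h : (-(K * K)).HasEigenvalue μ) :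
    0 < μ := by
  obtain ⟨u, hu, hu0⟩ := h.exists_hasEigenvector
  have h1 := inner_neg_sq_of_skew hK u u
  rw [mem_eigenspace_iff.mp hu, inner_smul_left, real_inner_self_eq_norm_sq,
    real_inner_self_eq_norm_sq, conj_trivial] at h1
  have h2 : 0 < ‖u‖ ^ 2 := by positivity
  have h3 : 0 ≤ μ := nonneg_of_mul_nonneg_left (by rw [h1]; positivity) h2
  exact lt_of_le_of_ne h3 hμ.symm

/-- On the eigenspace for `μ ≠ 0` the operator `K / √μ` is a complex structure. -/
theorem even_finrank_eigenspace_neg_sq [FiniteDimensional ℝ E] {μ : ℝ} (hμ : μ ≠ 0) :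
    Even (Module.finrank ℝ (eigenspace (-(K * K)) μ)) := by
  by_cases h : (-(K * K)).HasEigenvalue μ
  swap
  · rw [show eigenspace (-(K * K)) μ = ⊥ from not_not.mp h, finrank_bot]
    exact Even.zero
  have hpos := pos_of_hasEigenvalue_neg_sq hK hμ h
  have hmaps : ∀ u ∈ eigenspace (-(K * K)) μ, ((√μ)⁻¹ • K) u ∈ eigenspace (-(K * K)) μ := by
    intro u hu
    refine Submodule.smul_mem _ _ (mem_eigenspace_iff.mpr ?_)
    rw [← map_smul, ← mem_eigenspace_iff.mp hu]
    simp
  refine even_finrank_of_sq_eq_neg_one (((√μ)⁻¹ • K).restrict hmaps) ?_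
  ext u
  have hu := mem_eigenspace_iff.mp u.2
  rw [LinearMap.neg_apply, Module.End.mul_apply, neg_eq_iff_eq_neg] at hu
  simp only [Module.End.mul_apply, LinearMap.coe_restrict_apply, LinearMap.smul_apply, map_smul,
    hu, smul_smul, LinearMap.neg_apply, Module.End.one_apply, Submodule.coe_neg]
  rw [smul_neg, smul_smul, ← mul_inv, Real.mul_self_sqrt hpos.le, inv_mul_cancel₀ hμ, one_smul]

/-- An eigenspace of dimension at least three contains two orthogonal planes on which `K` is `√μ`
times a rotation by a right angle. -/
theorem exists_orthonormal_frame_of_skew [FiniteDimensional ℝ E] {μ : ℝ} (hμ : μ ≠ 0)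
    (h : 3 ≤ Module.finrank ℝ (eigenspace (-(K * K)) μ)) :
    ∃ (l : ℝ) (e : Fin 4 → E), l ≠ 0 ∧ Orthonormal ℝ e ∧ (∀ i, e i ∈ eigenspace (-(K * K)) μ) ∧
      K (e 0) = l • e 1 ∧ K (e 1) = -(l • e 0) ∧ K (e 2) = l • e 3 ∧ K (e 3) = -(l • e 2) := by
  set M := eigenspace (-(K * K)) μ with hM
  have hev : (-(K * K)).HasEigenvalue μ := fun h0 => by
    rw [show M = ⊥ from h0, finrank_bot] at h
    omega
  have hpos := pos_of_hasEigenvalue_neg_sq hK hμ hev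
  have hl : √μ ≠ 0 := (Real.sqrt_pos.mpr hpos).ne'
  have hll : √μ * √μ = μ := Real.mul_self_sqrt hpos.le
  have hself : ∀ u, inner ℝ u (K u) = 0 := fun u => by
    have := hK u u
    rw [real_inner_comm] at this
    linarith
  -- the partner of a unit eigenvector
  have hpartner : ∀ u ∈ M, ‖u‖ = 1 → ∃ w ∈ M, ‖w‖ = 1 ∧ inner ℝ u w = 0 ∧ K u = √μ • w ∧
      K w = -(√μ • u) := by
    intro u hu hu1
    have hu' := mem_eigenspace_iff.mp hu
    have hKK : K (K u) = -(μ • u) := by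
      rw [← hu']; simp
    refine ⟨(√μ)⁻¹ • K u, Submodule.smul_mem _ _ (mem_eigenspace_iff.mpr ?_), ?_, ?_, ?_, ?_⟩
    · rw [LinearMap.neg_apply, Module.End.mul_apply, hKK, map_neg, neg_neg, map_smul]
    · have h1 := inner_neg_sq_of_skew hK u u
      rw [hu', inner_smul_left, real_inner_self_eq_norm_sq, real_inner_self_eq_norm_sq, hu1,
        conj_trivial, one_pow, mul_one] at h1
      rw [norm_smul, h1, Real.sqrt_sq (norm_nonneg _), norm_inv, norm_norm]
      refine inv_mul_cancel₀ fun h0 => hμ ?_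
      rw [h1, h0]
      norm_num
    · rw [inner_smul_right, hself, mul_zero]
    · rw [smul_smul, mul_inv_cancel₀ hl, one_smul]
    · rw [map_smul, hKK, smul_neg, smul_smul]
      nth_rewrite 2 [← hll]
      rw [← mul_assoc, inv_mul_cancel₀ hl, one_mul]
  have hunit : ∀ N : Submodule ℝ E, N ≠ ⊥ → ∃ u ∈ N, ‖u‖ = 1 := fun N hN => by
    have := Submodule.nontrivial_iff_ne_bot.mpr hN
    obtain ⟨u, hu⟩ := exists_norm_eq N (zero_le_one (α := ℝ))
    exact ⟨u, u.2, hu⟩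
  obtain ⟨a, ha, ha1⟩ := hunit M hev
  obtain ⟨b, hb, hb1, hab, hKa, hKb⟩ := hpartner a ha ha1
  set N : Submodule ℝ E := Submodule.span ℝ {a, b} with hN
  have hNM : M ⊓ Nᗮ ≠ ⊥ := by
    intro h0
    have h1 := Submodule.finrank_sup_add_finrank_inf_eq M Nᗮ
    have h2 := Submodule.finrank_add_finrank_orthogonal N
    have h3 : Module.finrank ℝ N ≤ 2 := by
      classical
      have := finrank_span_finset_le_card (R := ℝ) ({a, b} : Finset E)
      rw [Finset.coe_pair] at this
      exact this.trans Finset.card_le_two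
    have h4 := Submodule.finrank_le (M ⊔ Nᗮ)
    rw [h0, finrank_bot] at h1
    omega
  obtain ⟨c, ⟨hc, hcN⟩, hc1⟩ := hunit _ hNM
  obtain ⟨d, hd, hd1, hcd, hKc, hKd⟩ := hpartner c hc hc1
  have hac : inner ℝ a c = (0 : ℝ) := hcN a (Submodule.subset_span (by simp))
  have hbc : inner ℝ b c = (0 : ℝ) := hcN b (Submodule.subset_span (by simp))
  have had : inner ℝ a d = (0 : ℝ) := by
    have h1 := hK a c
    rw [hKa, hKc, inner_smul_left, inner_smul_right, hbc, mul_zero, zero_eq_neg, mul_eq_zero] at h1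
    exact h1.resolve_left hl
  have hbd : inner ℝ b d = (0 : ℝ) := by
    have h1 := hK b c
    rw [hKb, hKc, inner_neg_left, inner_smul_left, inner_smul_right, hac, mul_zero, neg_zero,
      zero_eq_neg, mul_eq_zero] at h1
    exact h1.resolve_left hl
  refine ⟨√μ, ![a, b, c, d], hl, ⟨?_, ?_⟩, ?_, hKa, hKb, hKc, hKd⟩
  · intro i
    fin_cases i <;> assumption
  · have hsymm : ∀ {p q : E}, inner ℝ p q = (0 : ℝ) → inner ℝ q p = (0 : ℝ) := fun h => by
      rw [real_inner_comm]; exact h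
    intro i j hij
    fin_cases i <;> fin_cases j <;>
      first | exact absurd rfl hij | assumption | exact hsymm (by assumption)
  · intro i
    fin_cases i <;> assumption

end Skew

/-! ### The operator `K̂` and its first variation -/

section Khat

open Module.End

variable {z v : Type*} [NormedAddCommGroup z] [InnerProductSpace ℝ z] [FiniteDimensional ℝ z]
  [NormedAddCommGroup v] [InnerProductSpace ℝ v] [FiniteDimensional ℝ v]
  [Module (CliffordAlgebra (cliffordForm z)) v]
  [IsScalarTower ℝ (CliffordAlgebra (cliffordForm z)) v]

/-- The operator `K̂(x ⊕ S)`. -/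
noncomputable def khat (x : z) (S : v) : Module.End ℝ z :=
  Khat (WithLp.toLp 2 (x, S))

/-- The operator `-K̂(x ⊕ S)²`. -/
noncomputable def negKhatSq (x : z) (S : v) : Module.End ℝ z :=
  -(khat x S * khat x S)

/-- The first variation of `K̂(x ⊕ S)` in the direction `T` of the spinor component. -/
noncomputable def khatVariation (x : z) (S T : v) : Module.End ℝ z :=
  LinearMap.adjoint (cmul.flip S) ∘ₗ cmul.flip (cmul x T) +
    LinearMap.adjoint (cmul.flip T) ∘ₗ cmul.flip (cmul x S)

theorem inner_khat (x : z) (S : v) (Z W : z) :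
    inner ℝ (khat x S Z) W = inner ℝ (cmul Z (cmul x S)) (cmul W S) :=
  inner_Khat _ _ _

theorem inner_khatVariation (x : z) (S T : v) (Z W : z) :
    inner ℝ (khatVariation x S T Z) W =
      inner ℝ (cmul Z (cmul x T)) (cmul W S) + inner ℝ (cmul Z (cmul x S)) (cmul W T) := by
  simp [khatVariation, LinearMap.adjoint_inner_left, inner_add_left]

theorem khat_add_smul (x : z) (S T : v) (t : ℝ) :
    khat x (S + t • T) = khat x S + t • khatVariation x S T + t ^ 2 • khat x T := by
  refine LinearMap.ext fun Z => ext_inner_right ℝ fun W => ?_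
  simp only [LinearMap.add_apply, LinearMap.smul_apply, inner_add_left, inner_smul_left, inner_khat,
    inner_khatVariation, map_add, map_smul, inner_add_right, inner_smul_right, conj_trivial]
  ring

theorem hasDerivAt_negKhatSq (x : z) (S T : v) :
    HasDerivAt (fun t : ℝ => Module.End.toContinuousLinearMap z (negKhatSq x (S + t • T)))
      (Module.End.toContinuousLinearMap z
        (-(khatVariation x S T * khat x S + khat x S * khatVariation x S T))) 0 := by
  set φ := Module.End.toContinuousLinearMap (𝕜 := ℝ) z
  have h1 : HasDerivAt (fun t : ℝ => φ (khat x S) + t • φ (khatVariation x S T) +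
      t ^ 2 • φ (khat x T)) (φ (khatVariation x S T)) 0 := by
    have h2 := ((hasDerivAt_id (0 : ℝ)).smul_const (φ (khatVariation x S T))).const_add
      (φ (khat x S))
    have h3 := ((hasDerivAt_id (0 : ℝ)).pow 2).smul_const (φ (khat x T))
    exact (h2.add h3).congr_deriv (by simp)
  have h4 := (h1.mul h1).neg
  have hfun : (fun t : ℝ => φ (negKhatSq x (S + t • T))) = -((fun t : ℝ => φ (khat x S) +
      t • φ (khatVariation x S T) + t ^ 2 • φ (khat x T)) * (fun t : ℝ => φ (khat x S) +
      t • φ (khatVariation x S T) + t ^ 2 • φ (khat x T))) := by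
    funext t
    simp [negKhatSq, khat_add_smul]
  rw [hfun]
  exact h4.congr_deriv (by simp)

variable (hv : IsOrthogonalModule z v)

include hv

theorem IsOrthogonalModule.khat_skew (x : z) (S : v) (Z W : z) :
    inner ℝ (khat x S Z) W = -inner ℝ Z (khat x S W) := by
  have h0 : ∀ Y : z, inner ℝ (khat x S Y) Y = 0 := fun Y => by
    rw [inner_khat, hv.inner_cmul_cmul, hv.inner_cmul_self, mul_zero]
  have h := h0 (Z + W)
  rw [map_add, inner_add_left, inner_add_right, inner_add_right, h0, h0] at h
  rw [real_inner_comm _ Z]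
  linarith

theorem IsOrthogonalModule.khat_self (x : z) (S : v) : khat x S x = 0 := by
  refine ext_inner_right ℝ fun W => ?_
  rw [inner_khat, cmul_cmul, inner_neg_left, inner_smul_left, real_inner_comm,
    hv.inner_cmul_self, mul_zero, neg_zero, inner_zero_left]

theorem IsOrthogonalModule.isSymmetric_negKhatSq (x : z) (S : v) :
    (negKhatSq x S).IsSymmetric :=
  isSymmetric_neg_sq_of_skew (hv.khat_skew x S)

theorem IsOrthogonalModule.inner_khatVariation_of_orthogonal {x Z W : z} (hZW : inner ℝ Z W = 0)
    (hxZ : inner ℝ x Z = 0) (hxW : inner ℝ x W = 0) (S T : v) :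
    inner ℝ (khatVariation x S T Z) W = 2 * inner ℝ (cmul x (cmul Z (cmul W S))) T := by
  have h1 : inner ℝ (cmul Z (cmul x T)) (cmul W S) = inner ℝ T (cmul x (cmul Z (cmul W S))) := by
    rw [hv, hv, neg_neg]
  have h2 : inner ℝ (cmul Z (cmul x S)) (cmul W T) = inner ℝ (cmul x (cmul Z (cmul W S))) T := by
    have h3 : cmul W (cmul Z (cmul x S)) = -cmul x (cmul Z (cmul W S)) := by
      rw [cmul_anticomm ((real_inner_comm Z W).trans hZW),
        cmul_anticomm ((real_inner_comm x W).trans hxW), map_neg, neg_neg,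
        cmul_anticomm ((real_inner_comm x Z).trans hxZ)]
    have h4 := hv W (cmul Z (cmul x S)) T
    rw [h3, inner_neg_left, neg_inj] at h4
    exact h4.symm
  rw [inner_khatVariation, h1, h2, real_inner_comm T, two_mul]

/-- If the number of eigenvalues of `-K̂(x ⊕ S)²` does not increase under small perturbations
of `S`, then an eigenspace of dimension at least three for a nonzero eigenvalue forces a
four-dimensional volume element to act on `S` as `-1`. -/
theorem IsOrthogonalModule.mem_badSpinors {x : z} (hx : x ≠ 0) {S : v}
    (hcount : ∀ T : v, ∀ᶠ t : ℝ in 𝓝 0,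
      eigenCount (negKhatSq x (S + t • T)) ≤ eigenCount (negKhatSq x S))
    {μ : ℝ} (hμ : μ ≠ 0) (h3 : 3 ≤ Module.finrank ℝ (eigenspace (negKhatSq x S) μ)) :
    S ∈ badSpinors v x := by
  obtain ⟨l, e, hl, he, hmem, h01, h10, h23, h32⟩ :=
    exists_orthonormal_frame_of_skew (hv.khat_skew x S) hμ h3
  have hxe : ∀ i, inner ℝ x (e i) = 0 := fun i => by
    have h1 := inner_neg_sq_of_skew (hv.khat_skew x S) x (e i)
    rw [hv.khat_self, inner_zero_left, isSymmetric_neg_sq_of_skew (hv.khat_skew x S),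
      mem_eigenspace_iff.mp (hmem i), inner_smul_right, mul_eq_zero] at h1
    exact h1.resolve_left hμ
  have hkey : cmul x (cmul (e 0) (cmul (e 1) S)) = cmul x (cmul (e 2) (cmul (e 3) S)) := by
    refine ext_inner_right ℝ fun T => ?_
    obtain ⟨s, hs⟩ := exists_compression_eq_smul (A := fun t => negKhatSq x (S + t • T))
      (fun t => hv.isSymmetric_negKhatSq x _) (hasDerivAt_negKhatSq x S T)
      (by simpa using hcount T) μ
    simp only [zero_smul, add_zero] at hs
    -- both inner products are `s / (4 l)`
    have hpair : ∀ a b : z, a ∈ eigenspace (negKhatSq x S) μ → ‖a‖ = 1 → inner ℝ a b = 0 →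
        inner ℝ x a = 0 → inner ℝ x b = 0 → khat x S a = l • b → khat x S b = -(l • a) →
        4 * l * inner ℝ (cmul x (cmul a (cmul b S))) T = s := by
      intro a b ha ha1 hab hxa hxb hKa hKb
      have h1 := hs a ha a ha
      have h2 := hv.inner_khatVariation_of_orthogonal hab hxa hxb S T
      have h4 := hv.inner_khatVariation_of_orthogonal
        ((real_inner_comm a b).trans hab) hxb hxa S T
      rw [cmul_anticomm ((real_inner_comm a b).trans hab), map_neg,
        inner_neg_left] at h4
      rw [real_inner_self_eq_norm_sq, ha1, LinearMap.neg_apply, inner_neg_left,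
        LinearMap.add_apply, inner_add_left, Module.End.mul_apply, Module.End.mul_apply, hKa,
        hv.khat_skew, hKa, map_smul, inner_smul_left, inner_smul_right, h2, h4, conj_trivial] at h1
      linarith
    have ha := hpair (e 0) (e 1) (hmem 0) (he.1 0) (he.2 (by decide)) (hxe 0) (hxe 1) h01 h10
    have hb := hpair (e 2) (e 3) (hmem 2) (he.1 2) (he.2 (by decide)) (hxe 2) (hxe 3) h23 h32
    exact mul_left_cancel₀ (mul_ne_zero four_ne_zero hl) (ha.trans hb.symm)
  refine ⟨e, he, hxe, ?_⟩
  have h1 := cmul_injective hx hkey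
  rw [quad_apply, ← h1, cmul_anticomm (he.2 (show (1 : Fin 4) ≠ 0 by decide)), map_neg,
    cmul_cmul_of_norm_eq_one (he.1 0), neg_neg, cmul_cmul_of_norm_eq_one (he.1 1)]

end Khat

/-! ### Ranks and eigenvalue multiplicities -/

section Rank

open Module.End Filter

variable {E : Type*} [NormedAddCommGroup E] [InnerProductSpace ℝ E]

theorem eigenspace_smul_mul {a : ℝ} (ha : a ≠ 0) (A : Module.End ℝ E) (c : ℝ) :
    eigenspace (a • A) (a * c) = eigenspace A c := by
  ext u
  rw [mem_eigenspace_iff, mem_eigenspace_iff, LinearMap.smul_apply, mul_smul]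
  exact (smul_right_injective E ha).eq_iff

theorem eigenspace_smul {a : ℝ} (ha : a ≠ 0) (A : Module.End ℝ E) (c : ℝ) :
    eigenspace (a • A) c = eigenspace A (a⁻¹ * c) := by
  rw [← eigenspace_smul_mul ha A (a⁻¹ * c), mul_inv_cancel_left₀ ha]

theorem finrank_range_smul {a : ℝ} (ha : a ≠ 0) (A : Module.End ℝ E) :
    Module.finrank ℝ (LinearMap.range (a • A)) = Module.finrank ℝ (LinearMap.range A) := by
  rw [LinearMap.range_smul _ _ ha]

theorem eigenCount_smul {a : ℝ} (ha : a ≠ 0) (A : Module.End ℝ E) :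
    eigenCount (a • A) = eigenCount A := by
  have h : {c : ℝ | (a • A).HasEigenvalue c} = (a * ·) '' {c : ℝ | A.HasEigenvalue c} := by
    ext c
    constructor
    · intro hc
      refine ⟨a⁻¹ * c, ?_, mul_inv_cancel_left₀ ha c⟩
      intro h0
      exact hc (by rw [← h0]; exact eigenspace_smul ha A c)
    · rintro ⟨d, hd, rfl⟩ h0
      exact hd (by rw [← h0]; exact (eigenspace_smul_mul ha A d).symm)
  rw [eigenCount, h, Set.ncard_image_of_injective _ (mul_right_injective₀ ha), eigenCount]

variable [FiniteDimensional ℝ E]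

theorem finrank_range_eq_sum {A : Module.End ℝ E} (hA : A.IsSymmetric) :
    Module.finrank ℝ (LinearMap.range A) =
      ∑ c ∈ (eigenFinset A).erase 0, Module.finrank ℝ (eigenspace A c) := by
  have h1 := LinearMap.finrank_range_add_finrank_ker A
  rw [← eigenspace_zero, ← sum_finrank_eigenspace hA] at h1
  by_cases h0 : A.HasEigenvalue 0
  · rw [← Finset.sum_erase_add _ _ (mem_eigenFinset.mpr h0)] at h1
    exact Nat.add_right_cancel h1
  · rw [show eigenspace A 0 = ⊥ from not_not.mp h0, finrank_bot, add_zero] at h1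
    rw [h1, Finset.erase_eq_of_notMem (fun h => h0 (mem_eigenFinset.mp h))]

theorem finrank_range_mul_self {A : Module.End ℝ E} (hA : A.IsSymmetric) :
    Module.finrank ℝ (LinearMap.range (A * A)) = Module.finrank ℝ (LinearMap.range A) := by
  have h : LinearMap.ker (A * A) = LinearMap.ker A := by
    ext u
    rw [LinearMap.mem_ker, LinearMap.mem_ker, Module.End.mul_apply]
    refine ⟨fun hu => ?_, fun hu => by rw [hu, map_zero]⟩
    have := hA (A u) u
    rw [hu, inner_zero_left] at this
    exact inner_self_eq_zero.mp this.symm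
  have h1 := LinearMap.finrank_range_add_finrank_ker A
  have h2 := LinearMap.finrank_range_add_finrank_ker (A * A)
  rw [h] at h2
  omega

theorem finrank_range_mul_sub_lt {A : Module.End ℝ E} {c : ℝ} (hc : A.HasEigenvalue c)
    (hc0 : c ≠ 0) :
    Module.finrank ℝ (LinearMap.range (A * (A - c • 1))) < Module.finrank ℝ (LinearMap.range A) := by
  obtain ⟨u, hu, hu0⟩ := hc.exists_hasEigenvector
  have hu' := mem_eigenspace_iff.mp hu
  have h : LinearMap.ker A < LinearMap.ker (A * (A - c • 1)) := by
    refine lt_of_le_of_ne (fun w hw => ?_) fun heq => ?_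
    · have hw' : A w = 0 := hw
      simp [hw']
    · have h1 : u ∈ LinearMap.ker (A * (A - c • 1)) := by simp [hu']
      rw [← heq, LinearMap.mem_ker, hu', smul_eq_zero] at h1
      exact h1.elim hc0 hu0
  have h1 := LinearMap.finrank_range_add_finrank_ker A
  have h2 := LinearMap.finrank_range_add_finrank_ker (A * (A - c • 1))
  have h3 := Submodule.finrank_lt_finrank_of_lt h
  omega

/-- Lower semicontinuity of the rank. -/
theorem eventually_finrank_range_le {α : Type*} {l : Filter α} {F : α → Module.End ℝ E}
    {A : Module.End ℝ E} (h : Tendsto (fun a => Module.End.toContinuousLinearMap E (F a)) l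
      (𝓝 (Module.End.toContinuousLinearMap (𝕜 := ℝ) E A))) :
    ∀ᶠ a in l, Module.finrank ℝ (LinearMap.range A) ≤ Module.finrank ℝ (LinearMap.range (F a)) := by
  have hopen := isOpen_setOfPred_nat_le_rank (𝕜 := ℝ) (E := E) (F := E)
    (Module.finrank ℝ (LinearMap.range A))
  have hiff : ∀ B : Module.End ℝ E, Module.End.toContinuousLinearMap (𝕜 := ℝ) E B ∈
      {f : E →L[ℝ] E | ((Module.finrank ℝ (LinearMap.range A) : ℕ) : Cardinal) ≤
        (f : E →ₗ[ℝ] E).rank} ↔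
      Module.finrank ℝ (LinearMap.range A) ≤ Module.finrank ℝ (LinearMap.range B) := by
    intro B
    change ((Module.finrank ℝ (LinearMap.range A) : ℕ) : Cardinal) ≤
      Module.rank ℝ (LinearMap.range B) ↔ _
    rw [← Module.finrank_eq_rank, Nat.cast_le]
  filter_upwards [h.eventually (hopen.mem_nhds ((hiff A).mpr le_rfl))] with a ha
  exact (hiff _).mp ha

end Rank

/-! ### Multiplicities on the complement of the ramification locus -/

section Domain

variable {z v : Type*} [NormedAddCommGroup z] [NormedAddCommGroup v]

theorem scale_ne_zero {X : WithLp 2 (z × v)} (hX : X ∈ domainD z v) :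
    (‖X.fst‖ * ‖X.snd‖ ^ 2)⁻¹ ^ 2 ≠ 0 := by
  have h1 := norm_ne_zero_iff.mpr hX.1
  have h2 := norm_ne_zero_iff.mpr hX.2
  positivity

end Domain

section Regular

open Module.End Filter

variable {z v : Type*} [NormedAddCommGroup z] [InnerProductSpace ℝ z] [FiniteDimensional ℝ z]
  [NormedAddCommGroup v] [InnerProductSpace ℝ v] [FiniteDimensional ℝ v]
  [Module (CliffordAlgebra (cliffordForm z)) v]
  [IsScalarTower ℝ (CliffordAlgebra (cliffordForm z)) v]

theorem continuous_negKhatSq : Continuous fun X : WithLp 2 (z × v) =>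
    Module.End.toContinuousLinearMap z (negKhatSq X.fst X.snd) := by
  have h : Continuous fun X : WithLp 2 (z × v) =>
      Module.End.toContinuousLinearMap z (khat X.fst X.snd) := by
    rw [continuous_clm_apply]
    intro Z
    have hc : ∀ (Z : z) (S : v), cmul Z S =
        (cmul : z →ₗ[ℝ] v →ₗ[ℝ] v).toContinuousBilinearMap Z S :=
      fun Z S => (LinearMap.toContinuousBilinearMap_apply _ _ _).symm
    let b := stdOrthonormalBasis ℝ z
    have hsum : ∀ X : WithLp 2 (z × v), Module.End.toContinuousLinearMap z (khat X.fst X.snd) Z =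
        ∑ i, inner ℝ (cmul (b i) X.snd) (cmul Z (cmul X.fst X.snd)) • b i := fun X => by
      rw [← b.sum_repr' (Module.End.toContinuousLinearMap z (khat X.fst X.snd) Z)]
      refine Finset.sum_congr rfl fun i _ => ?_
      congr 1
      rw [real_inner_comm, real_inner_comm (cmul Z (cmul X.fst X.snd))]
      exact inner_khat X.fst X.snd Z (b i)
    simp only [hsum, hc]
    have h1 := WithLp.continuous_fst (p := 2) (α := z) (β := v)
    have h2 := WithLp.continuous_snd (p := 2) (α := z) (β := v)
    fun_prop
  simp only [negKhatSq, map_neg, map_mul]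
  exact (h.mul h).neg

theorem negKcheckSq_eq (X : WithLp 2 (z × v)) :
    negKcheckSq X = ((‖X.fst‖ * ‖X.snd‖ ^ 2)⁻¹ ^ 2) • negKhatSq X.fst X.snd := by
  ext Z
  have h : khat X.fst X.snd = Khat X := rfl
  simp [negKcheckSq, Kcheck, negKhatSq, h, smul_smul, sq]

theorem continuousAt_negKcheckSq {X : WithLp 2 (z × v)} (hX : X ∈ domainD z v) :
    ContinuousAt (fun Y : WithLp 2 (z × v) =>
      Module.End.toContinuousLinearMap z (negKcheckSq Y)) X := by
  simp only [negKcheckSq_eq, map_smul]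
  have h1 := WithLp.continuous_fst (p := 2) (α := z) (β := v)
  have h2 := WithLp.continuous_snd (p := 2) (α := z) (β := v)
  have h3 : ‖X.fst‖ * ‖X.snd‖ ^ 2 ≠ 0 :=
    mul_ne_zero (norm_ne_zero_iff.mpr hX.1) (pow_ne_zero 2 (norm_ne_zero_iff.mpr hX.2))
  have h4 : ContinuousAt (fun Y : WithLp 2 (z × v) => (‖Y.fst‖ * ‖Y.snd‖ ^ 2)⁻¹ ^ 2) X :=
    ((h1.norm.mul (h2.norm.pow 2)).continuousAt.inv₀ h3).pow 2
  exact h4.smul continuous_negKhatSq.continuousAt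

theorem numEigenvalues_eq {X : WithLp 2 (z × v)} (hX : X ∈ domainD z v) :
    numEigenvalues X = eigenCount (negKhatSq X.fst X.snd) := by
  rw [← eigenCount_smul (scale_ne_zero hX), ← negKcheckSq_eq]
  rfl

variable (hv : IsOrthogonalModule z v)

include hv

theorem IsOrthogonalModule.isSymmetric_negKcheckSq (X : WithLp 2 (z × v)) :
    (negKcheckSq X).IsSymmetric := by
  rw [negKcheckSq_eq]
  exact (hv.isSymmetric_negKhatSq _ _).smul (conj_trivial _)

/-- The vector `x` itself lies in the kernel of `K̂(x ⊕ S)`. -/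
theorem IsOrthogonalModule.hasEigenvalue_zero {x : z} (hx : x ≠ 0) (S : v) :
    (negKhatSq x S).HasEigenvalue 0 := by
  refine hasEigenvalue_of_hasEigenvector (x := x) ⟨mem_eigenspace_iff.mpr ?_, hx⟩
  rw [negKhatSq, LinearMap.neg_apply, Module.End.mul_apply, hv.khat_self, map_zero, neg_zero,
    zero_smul]

theorem IsOrthogonalModule.two_le_finrank_eigenspace {x : z} {S : v} {c : ℝ}
    (hc : (negKhatSq x S).HasEigenvalue c) (hc0 : c ≠ 0) :
    2 ≤ Module.finrank ℝ (eigenspace (negKhatSq x S) c) := by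
  obtain ⟨r, hr⟩ := even_finrank_eigenspace_neg_sq (hv.khat_skew x S) hc0
  have : Module.finrank ℝ (eigenspace (negKhatSq x S) c) ≠ 0 := fun h =>
    hc (Submodule.finrank_eq_zero.mp h)
  change Module.finrank ℝ (eigenspace (negKhatSq x S) c) = r + r at hr
  omega

/-- Where the number of eigenvalues is locally constant, all nonzero eigenvalues have multiplicity
two: this holds at nearby spinors outside `badSpinors x`, so the rank of the operator there is
`2 * (k - 1)` for `k` the number of eigenvalues, and the rank is lower semicontinuous. -/
theorem IsOrthogonalModule.finrank_eigenspace_eq_two {x : z} (hx : x ≠ 0)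
    (hdense : Dense (badSpinors v x)ᶜ) {S : v}
    (hS : ∀ᶠ T in 𝓝 S, eigenCount (negKhatSq x T) = eigenCount (negKhatSq x S)) :
    (∀ c, (negKhatSq x S).HasEigenvalue c → c ≠ 0 →
      Module.finrank ℝ (eigenspace (negKhatSq x S) c) = 2) ∧
    Module.finrank ℝ (LinearMap.range (negKhatSq x S)) = 2 * (eigenCount (negKhatSq x S) - 1) := by
  have hcard : ∀ T : v, ((eigenFinset (negKhatSq x T)).erase 0).card =
      eigenCount (negKhatSq x T) - 1 := fun T => by
    rw [Finset.card_erase_of_mem (mem_eigenFinset.mpr (hv.hasEigenvalue_zero hx T)),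
      card_eigenFinset]
  have hsum := fun T : v => finrank_range_eq_sum (hv.isSymmetric_negKhatSq x T)
  have hrank : ∀ᶠ T in 𝓝 S, Module.finrank ℝ (LinearMap.range (negKhatSq x S)) ≤
      Module.finrank ℝ (LinearMap.range (negKhatSq x T)) := by
    refine eventually_finrank_range_le ?_
    have h1 : Continuous fun T : v => WithLp.toLp 2 (x, T) := by fun_prop
    exact (continuous_negKhatSq.comp h1).continuousAt
  obtain ⟨T, hTbad, hTcount, hTrank⟩ : ∃ T, T ∈ (badSpinors v x)ᶜ ∧
      (∀ᶠ T' in 𝓝 T, eigenCount (negKhatSq x T') = eigenCount (negKhatSq x S)) ∧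
      Module.finrank ℝ (LinearMap.range (negKhatSq x S)) ≤
        Module.finrank ℝ (LinearMap.range (negKhatSq x T)) := by
    obtain ⟨T, h1, h2⟩ := hdense.inter_nhds_nonempty (hS.eventually_nhds.and hrank)
    exact ⟨T, h1, h2⟩
  have hT : ∀ c ∈ (eigenFinset (negKhatSq x T)).erase 0,
      Module.finrank ℝ (eigenspace (negKhatSq x T) c) ≤ 2 := by
    intro c hc
    by_contra! h3
    refine hTbad (hv.mem_badSpinors hx (fun T' => ?_) (Finset.ne_of_mem_erase hc) h3)
    have hline : Tendsto (fun t : ℝ => T + t • T') (𝓝 0) (𝓝 T) := by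
      have : Continuous fun t : ℝ => T + t • T' := by fun_prop
      simpa using this.tendsto 0
    filter_upwards [hline.eventually hTcount] with t ht
    rw [ht, hTcount.self_of_nhds]
  have hle : Module.finrank ℝ (LinearMap.range (negKhatSq x S)) ≤
      2 * (eigenCount (negKhatSq x S) - 1) := by
    refine hTrank.trans ?_
    rw [hsum, ← hTcount.self_of_nhds, ← hcard, mul_comm]
    exact Finset.sum_le_card_nsmul _ _ _ hT
  have hge : ∀ c ∈ (eigenFinset (negKhatSq x S)).erase 0,
      2 ≤ Module.finrank ℝ (eigenspace (negKhatSq x S) c) := fun c hc =>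
    hv.two_le_finrank_eigenspace (mem_eigenFinset.mp (Finset.mem_of_mem_erase hc))
      (Finset.ne_of_mem_erase hc)
  have hconst : ∑ _c ∈ (eigenFinset (negKhatSq x S)).erase 0, 2 =
      2 * (eigenCount (negKhatSq x S) - 1) := by
    rw [Finset.sum_const, hcard, smul_eq_mul, mul_comm]
  have heq := le_antisymm hle (by rw [hsum, ← hconst]; exact Finset.sum_le_sum hge)
  refine ⟨fun c hc hc0 => ?_, heq⟩
  rw [hsum, ← hconst] at heq
  exact ((Finset.sum_eq_sum_iff_of_le hge).mp heq.symm c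
    (Finset.mem_erase.mpr ⟨hc0, mem_eigenFinset.mpr hc⟩)).symm

theorem IsOrthogonalModule.finrank_eigenspace_of_mem_regularSet
    (hdense : ∀ x : z, x ≠ 0 → Dense (badSpinors v x)ᶜ)
    {X : WithLp 2 (z × v)} (hX : X ∈ regularSet z v) :
    (∀ c, (negKcheckSq X).HasEigenvalue c → c ≠ 0 →
      Module.finrank ℝ (eigenspace (negKcheckSq X) c) = 2) ∧
    Module.finrank ℝ (LinearMap.range (negKcheckSq X)) = 2 * (numEigenvalues X - 1) := by
  obtain ⟨hD, hev⟩ := hX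
  have hs := scale_ne_zero hD
  have hline : Tendsto (fun T : v => WithLp.toLp 2 (X.fst, T)) (𝓝 X.snd) (𝓝 X) := by
    have : Continuous fun T : v => WithLp.toLp 2 (X.fst, T) := by fun_prop
    exact this.tendsto X.snd
  have hS : ∀ᶠ T in 𝓝 X.snd,
      eigenCount (negKhatSq X.fst T) = eigenCount (negKhatSq X.fst X.snd) := by
    filter_upwards [hline.eventually hev, eventually_ne_nhds hD.2] with T hT hT0
    have hTD : WithLp.toLp 2 (X.fst, T) ∈ domainD z v := ⟨hD.1, hT0⟩
    rw [numEigenvalues_eq hD, numEigenvalues_eq hTD] at hT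
    exact hT
  obtain ⟨h1, h2⟩ := hv.finrank_eigenspace_eq_two hD.1 (hdense _ hD.1) hS
  rw [numEigenvalues_eq hD, negKcheckSq_eq, finrank_range_smul hs]
  refine ⟨fun c hc hc0 => ?_, h2⟩
  have hsp := eigenspace_smul hs (negKhatSq X.fst X.snd) c
  rw [hsp]
  refine h1 _ (fun h0 => hc ?_) (mul_ne_zero (inv_ne_zero hs) hc0)
  rw [← h0]
  exact hsp

/-- The zero set of an eigenvalue branch is open in the complement of the ramification locus,
since the rank of `-Ǩ²` is locally constant there. -/
theorem IsOrthogonalModule.eventually_eq_zero_of_eq_zero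
    (hdense : ∀ x : z, x ≠ 0 → Dense (badSpinors v x)ᶜ)
    {U : Set (WithLp 2 (z × v))} (hU : U ⊆ regularSet z v) {μ : WithLp 2 (z × v) → ℝ}
    (hμ : ∀ X ∈ U, (negKcheckSq X).HasEigenvalue (μ X)) {X : WithLp 2 (z × v)} (hX : X ∈ U)
    (hcont : ContinuousAt μ X) (h0 : μ X = 0) : ∀ᶠ Y in 𝓝[U] X, μ Y = 0 := by
  have hA := continuousAt_negKcheckSq (hU hX).1
  set φ := Module.End.toContinuousLinearMap (𝕜 := ℝ) z
  have hB : Tendsto (fun Y => φ (negKcheckSq Y * (negKcheckSq Y - μ Y • 1))) (𝓝 X)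
      (𝓝 (φ (negKcheckSq X * negKcheckSq X))) := by
    have h1 : ContinuousAt (fun Y => φ (negKcheckSq Y) * (φ (negKcheckSq Y) - μ Y • 1)) X :=
      hA.mul (hA.sub (hcont.smul continuousAt_const))
    have h2 := h1.tendsto
    rw [h0, zero_smul, sub_zero] at h2
    simpa only [map_mul, map_sub, map_smul, map_one] using h2
  filter_upwards [(eventually_finrank_range_le hB).filter_mono nhdsWithin_le_nhds,
    (hU hX).2.filter_mono nhdsWithin_le_nhds, self_mem_nhdsWithin] with Y hY hnum hYU
  -- a nonzero eigenvalue `μ Y` would make the rank of `A (A - μ Y)` drop below that of `A`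
  by_contra hne
  have h1 := finrank_range_mul_sub_lt (hμ Y hYU) hne
  rw [finrank_range_mul_self (hv.isSymmetric_negKcheckSq X)] at hY
  rw [(hv.finrank_eigenspace_of_mem_regularSet hdense (hU hX)).2] at hY
  rw [(hv.finrank_eigenspace_of_mem_regularSet hdense (hU hYU)).2, hnum] at h1
  omega

/-- A branch that is nonzero at one point of a connected part of the regular set vanishes nowhere
there. -/
theorem IsOrthogonalModule.branch_ne_zero
    (hdense : ∀ x : z, x ≠ 0 → Dense (badSpinors v x)ᶜ)
    {U : Set (WithLp 2 (z × v))} (hU : U ⊆ regularSet z v) (hconn : IsPreconnected U)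
    {μ : WithLp 2 (z × v) → ℝ} (hμ : IsEigenvalueBranch U μ) {X Y : WithLp 2 (z × v)}
    (hX : X ∈ U) (hX0 : μ X ≠ 0) (hY : Y ∈ U) : μ Y ≠ 0 := by
  have h := hconn.induction₂ (fun X Y => μ X = 0 ↔ μ Y = 0) (fun W hW => ?_)
    (fun _ _ _ _ _ _ h1 h2 => h1.trans h2) (fun _ _ _ _ h1 => h1.symm) hX hY
  · exact fun h0 => hX0 (h.mpr h0)
  · have hcont : ContinuousAt μ W := (hμ.1 W hW).continuousAt
    by_cases h0 : μ W = 0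
    · filter_upwards [hv.eventually_eq_zero_of_eq_zero hdense hU hμ.2 hW hcont h0] with V hV
      exact ⟨fun _ => hV, fun _ => h0⟩
    · filter_upwards [(hcont.eventually_ne h0).filter_mono nhdsWithin_le_nhds] with V hV
      exact ⟨fun h => absurd h h0, fun h => absurd h hV⟩

end Regular

end HType

theorem proposition5p7
    {z v : Type*} [NormedAddCommGroup z] [InnerProductSpace ℝ z] [FiniteDimensional ℝ z]
    [NormedAddCommGroup v] [InnerProductSpace ℝ v] [FiniteDimensional ℝ v] [Nontrivial v]
    [Module (CliffordAlgebra (HType.cliffordForm z)) v]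
    [IsScalarTower ℝ (CliffordAlgebra (HType.cliffordForm z)) v]
    (hv : HType.IsOrthogonalModule z v)
    (hn : 10 ≤ Module.finrank ℝ z) :
    (8 * (Module.finrank ℝ z : ℤ) - 28 < (Module.finrank ℝ v : ℤ)) ∧
    ∀ (U : Set (WithLp 2 (z × v))) (μ : WithLp 2 (z × v) → ℝ),
      HType.IsRegularComponent z v U →
      HType.IsEigenvalueBranch U μ →
      (∃ X ∈ U, μ X ≠ 0) →
      HType.HasBranchMultiplicity U μ 2 := by
  have hdim := hv.finrank_bound hn
  refine ⟨by omega, ?_⟩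
  rintro U μ ⟨X₀, -, rfl⟩ hμ ⟨X, hX, hX0⟩ Y hY
  have hdense : ∀ x : z, x ≠ 0 → Dense (HType.badSpinors v x)ᶜ := fun x hx =>
    HType.dense_compl_badSpinors hx (by omega) hdim
  have hU := connectedComponentIn_subset (HType.regularSet z v) X₀
  exact (hv.finrank_eigenspace_of_mem_regularSet hdense (hU hY)).1 _ (hμ.2 Y hY)
    (hv.branch_ne_zero hdense hU isPreconnected_connectedComponentIn hμ hX hX0 hY)
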